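/- Let $n\ge 0$ be an integer and let $\Lambda$ be an Artin algebra, i.e. an algebra over a commutative artinian ring $R$ that is finitely generated as an $R$-module. All modules below are finitely generated left $\Lambda$-modules. For a module $N$, let $\operatorname{soc}N$ be its socle and let $\operatorname{Gpd}N$ be its Gorenstein projective dimension, i.e. the least length of a resolution of $N$ by Gorenstein projective modules ($\infty$ if there is none of finite length); a module is Gorenstein projective if it is isomorphic to the kernel of a differential of an exact complex of finitely generated projective modules, indexed by $\mathbb Z$, that stays exact under $\operatorname{Hom}_\Lambda(-,\Lambda)$. Let $\operatorname{id}{}_\Lambda\Lambda$ be the injective dimension of the left module ${}_\Lambda\Lambda$, and let $\operatorname{domdim}\Lambda$ be the supremum of the $m$ such that the terms $I_j$ with $j<m$ of the minimal injective coresolution $0\to{}_\Lambda\Lambda\to I_0\to I_1\to\cdots$ are projective. Put $$\mathrm{GP}^{\le n}(\Lambda)=\{N : \operatorname{Gpd}N\le n\},\qquad \operatorname{sub}\Lambda=\{N : N \text{ embeds in } \Lambda^m \text{ for some } m\ge 0\}.$$ Theorem. $\Lambda$ is a minimal $n$-Auslander-Gorenstein algebra, that is, $\operatorname{id}{}_\Lambda\Lambda\le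 n+1\le\operatorname{domdim}\Lambda$, if and only if $$\mathrm{GP}^{\le n}(\Lambda)=\{N : \operatorname{Gpd}(\operatorname{soc}N)\le n\}=\operatorname{sub}\Lambda .$$ -/

import Mathlib

universe u

open CategoryTheory

namespace GorensteinSocle

/-- A totally acyclic complex over `Λ`: an exact complex `⋯ → P i → P (i + 1) → ⋯`, indexed by `ℤ`,
of finitely generated projective left `Λ`-modules, such that the complex of abelian groups
`⋯ → Hom(P (i + 2), Λ) → Hom(P (i + 1), Λ) → Hom(P i, Λ) → ⋯` is exact as well. -/
structure TotallyAcyclicComplex (Λ : Type u) [Ring Λ] where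
  /-- the terms of the complex -/
  P : ℤ → ModuleCat.{u} Λ
  /-- the differentials of the complex -/
  d : ∀ i : ℤ, P i →ₗ[Λ] P (i + 1)
  finite : ∀ i : ℤ, Module.Finite Λ (P i)
  projective : ∀ i : ℤ, Module.Projective Λ (P i)
  exact : ∀ i : ℤ, Function.Exact (d i) (d (i + 1))
  hom_exact : ∀ i : ℤ, Function.Exact
    (fun g : P (i + 1 + 1) →ₗ[Λ] Λ => g ∘ₗ d (i + 1)) (fun f : P (i + 1) →ₗ[Λ] Λ => f ∘ₗ d i)

/-- A (finitely generated) module is Gorenstein projective if it is isomorphic to the module of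
`0`-cocycles of a totally acyclic complex. -/
def IsGorensteinProjective (Λ : Type u) [Ring Λ] (M : Type u) [AddCommGroup M] [Module Λ M] :
    Prop :=
  ∃ C : TotallyAcyclicComplex Λ, Nonempty (M ≃ₗ[Λ] LinearMap.ker (C.d 0))

/-- A resolution `⋯ → G 2 → G 1 → G 0 → M → 0` of `M` by Gorenstein projective modules. -/
structure GorensteinProjectiveResolution (Λ : Type u) [Ring Λ] (M : Type u) [AddCommGroup M]
    [Module Λ M] where
  /-- the terms of the resolution -/
  G : ℕ → ModuleCat.{u} Λ
  /-- the differentials of the resolution -/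
  d : ∀ i : ℕ, G (i + 1) →ₗ[Λ] G i
  /-- the augmentation -/
  ε : G 0 →ₗ[Λ] M
  gorensteinProjective : ∀ i : ℕ, IsGorensteinProjective Λ (G i)
  surjective : Function.Surjective ε
  exact_zero : Function.Exact (d 0) ε
  exact_succ : ∀ i : ℕ, Function.Exact (d (i + 1)) (d i)

/-- The Gorenstein projective dimension: the least `m` such that `M` has a resolution
`0 → G m → ⋯ → G 1 → G 0 → M → 0` by Gorenstein projective modules, and `⊤` if there is no such
`m`. -/
noncomputable def gpd (Λ : Type u) [Ring Λ] (M : Type u) [AddCommGroup M] [Module Λ M] : ℕ∞ :=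
  sInf {m : ℕ∞ | ∃ r : GorensteinProjectiveResolution Λ M, ∀ i : ℕ, m < i → Subsingleton (r.G i)}

/-- The socle of a module: the sum of its simple submodules. -/
def socle (Λ : Type u) [Ring Λ] (M : Type u) [AddCommGroup M] [Module Λ M] : Submodule Λ M :=
  sSup {S : Submodule Λ M | IsSimpleModule Λ S}

/-- A submodule is essential if it meets every nonzero submodule nontrivially. -/
def IsEssential {Λ : Type u} [Ring Λ] {M : Type u} [AddCommGroup M] [Module Λ M]
    (S : Submodule Λ M) : Prop :=
  ∀ T : Submodule Λ M, S ⊓ T = ⊥ → T = ⊥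

/-- A minimal injective coresolution `0 → M → I 0 → I 1 → I 2 → ⋯`: an exact sequence in which
`I 0` is an injective envelope of `M` and `I (j + 1)` is an injective envelope of the image of the
differential `I j → I (j + 1)`. -/
structure MinimalInjectiveCoresolution (Λ : Type u) [Ring Λ] (M : Type u) [AddCommGroup M]
    [Module Λ M] where
  /-- the terms of the coresolution -/
  I : ℕ → ModuleCat.{u} Λ
  /-- the coaugmentation -/
  ι : M →ₗ[Λ] I 0
  /-- the differentials of the coresolution -/
  d : ∀ j : ℕ, I j →ₗ[Λ] I (j + 1)
  injective_module : ∀ j : ℕ, Module.Injective Λ (I j)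
  injective_ι : Function.Injective ι
  exact_zero : Function.Exact ι (d 0)
  exact_succ : ∀ j : ℕ, Function.Exact (d j) (d (j + 1))
  essential_zero : IsEssential (LinearMap.range ι)
  essential_succ : ∀ j : ℕ, IsEssential (LinearMap.range (d j))

/-- The dominant dimension of `Λ`: the largest `m`, possibly `⊤`, such that the terms `I j` with
`j < m` of the minimal injective coresolution of the left module `Λ` (which is unique up to
isomorphism) are projective. -/
noncomputable def domdim (Λ : Type u) [Ring Λ] : ℕ∞ :=
  sSup {m : ℕ∞ | ∃ r : MinimalInjectiveCoresolution Λ Λ,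
    ∀ j : ℕ, (j : ℕ∞) < m → Module.Projective Λ (r.I j)}

/-- The condition `id Λ ≤ n + 1 ≤ domdim Λ` on an Artin algebra `Λ`, for the left regular module,
that defines the minimal `n`-Auslander-Gorenstein algebras. -/
def IsMinimalAuslanderGorenstein (n : ℕ) (Λ : Type u) [Ring Λ] : Prop :=
  injectiveDimension (ModuleCat.of Λ Λ) ≤ ((n + 1 : ℕ) : WithBot ℕ∞) ∧
    ((n + 1 : ℕ) : ℕ∞) ≤ domdim Λ

/-- The class of finitely generated modules of Gorenstein projective dimension at most `n`. -/
def gpLE (n : ℕ) (Λ : Type u) [Ring Λ] : Set (FGModuleCat.{u} Λ) :=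
  {N | gpd Λ N ≤ n}

/-- The class of finitely generated modules whose socle has Gorenstein projective dimension
at most `n`. -/
def socGpLE (n : ℕ) (Λ : Type u) [Ring Λ] : Set (FGModuleCat.{u} Λ) :=
  {N | gpd Λ (socle Λ N) ≤ n}

/-- The class of finitely generated modules cogenerated by a finite direct sum of copies of `Λ`,
that is, embeddable in some `Λ ^ m`. -/
def sub (Λ : Type u) [Ring Λ] : Set (FGModuleCat.{u} Λ) :=
  {N | ∃ (m : ℕ) (f : N →ₗ[Λ] (Fin m → Λ)), Function.Injective f}

end GorensteinSocle

/-!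
Call a module `X` torsion if `Hom(X, Λ) = 0`, and torsionless if linear forms separate its
elements. Finitely generated torsionless modules are exactly the members of `sub Λ`, and if `Λ`
embeds in a module `E` that is both projective and injective, then the common kernel of all linear
forms on a module is torsion, so that `sub Λ` is detected on the socle.

Suppose that `id Λ ≤ n + 1 ≤ domdim Λ`. Then `Λ` has a coresolution of length `n + 1` whose terms
are all injective and, except for the last one, projective. Hence `Ext^i(X, Λ) = 0` for torsion
`X` and `i ≤ n`, the same holds with a Gorenstein projective module in place of `Λ`, and dimension
shifting gives `Hom(X, N) = 0` for torsion `X` whenever `Gpd N ≤ n`; so such an `N` is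
torsionless. For the other inclusion it is enough that every finitely generated `X` with `Ext^i(X,
Λ) = 0` for all `i ≥ 1` is torsionless, since then left approximations by free modules provide the
right half of a totally acyclic complex. Only `Ext^(n+1)` can be nonzero from the torsion
submodule of `X` to `Λ`, and it vanishes because it is squeezed between two groups that do. So
what is needed is that no nonzero finitely generated torsion module `K` has `Ext^(n+1)(K, Λ) = 0`,
and this reduces to simple modules.

That last fact (`not_extVanishes_of_simple`) amounts to saying that each indecomposable injective
module occurs in the coresolution of `Λ`, and it is proved by counting. The projective cover `P`
of a simple module `S` is a summand of `Λ`. If `P` is not injective, there is a torsion simple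
module `S'` with `Ext^(n+1)(S', P) ≠ 0`; if `P` is injective, let `S'` be a simple submodule of
`P`. The endomorphisms of `Λ` act transitively on the nonzero elements of `Ext^(n+1)(S', Λ)`
(`HasProjInjCoresolution.exists_endomorphism`), and an endomorphism of `P` that factors through
the projective cover of another simple module is nilpotent (`IsLocalCover.exists_pow_eq_zero`).
Hence `S'` determines `S`, and as there are finitely many simple modules, every simple module is
some `S'`.

Conversely, suppose that the three classes agree. Left ideals lie in `sub Λ`, so `Ext^(n+1)(J, Λ)
= 0` for each of them and Baer's criterion gives `id Λ ≤ n + 1`. As `sub Λ` is detected on the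
socle, it is closed under essential extensions, and so under injective hulls, once these are known
to be finitely generated; therefore the injective hull of a module in `sub Λ` is projective.
Inductively the `j`-th cosyzygy of `Λ` has Gorenstein projective dimension at most `j`, lies in
`sub Λ` as long as `j ≤ n`, and thus has a projective injective hull.
-/

open CategoryTheory.Abelian

namespace GorensteinSocle

/-! ### Short exact sequences of modules -/

section ShortExact

variable {Λ : Type u} [Ring Λ] {A B C : Type u} [AddCommGroup A] [Module Λ A]
  [AddCommGroup B] [Module Λ B] [AddCommGroup C] [Module Λ C]

/-- `0 → A → B → C → 0` is a short exact sequence of modules. -/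
structure IsShortExact (f : A →ₗ[Λ] B) (g : B →ₗ[Λ] C) : Prop where
  injective : Function.Injective f
  surjective : Function.Surjective g
  exact : Function.Exact f g

namespace IsShortExact

variable {f : A →ₗ[Λ] B} {g : B →ₗ[Λ] C}

/-- The short complex in the category of modules. -/
abbrev toShortComplex (h : IsShortExact f g) : ShortComplex (ModuleCat.{u} Λ) :=
  ShortComplex.mk (ModuleCat.ofHom f) (ModuleCat.ofHom g) (by
    ext x
    exact h.exact.apply_apply_eq_zero x)

lemma shortExact (h : IsShortExact f g) : h.toShortComplex.ShortExact :=
  ModuleCat.shortComplex_shortExact _ h.exact h.injective h.surjective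

end IsShortExact

lemma isShortExact_ker (g : B →ₗ[Λ] C) (hg : Function.Surjective g) :
    IsShortExact (LinearMap.ker g).subtype g :=
  ⟨Subtype.val_injective, hg, LinearMap.exact_subtype_ker_map g⟩

lemma isShortExact_mkQ (f : A →ₗ[Λ] B) (hf : Function.Injective f) :
    IsShortExact f (LinearMap.range f).mkQ :=
  ⟨hf, Submodule.mkQ_surjective _, LinearMap.exact_map_mkQ_range f⟩

end ShortExact

/-! ### Vanishing of extension groups -/

/-- The extension group `Ext^i(X, Y)` vanishes. -/
def ExtVanishes (Λ : Type u) [Ring Λ] (i : ℕ) (X Y : Type u) [AddCommGroup X] [Module Λ X]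
    [AddCommGroup Y] [Module Λ Y] : Prop :=
  ∀ e : Ext (ModuleCat.of Λ X) (ModuleCat.of Λ Y) i, e = 0

namespace ExtVanishes

variable {Λ : Type u} [Ring Λ] {A B C X Y : Type u} [AddCommGroup A] [Module Λ A]
  [AddCommGroup B] [Module Λ B] [AddCommGroup C] [Module Λ C] [AddCommGroup X] [Module Λ X]
  [AddCommGroup Y] [Module Λ Y] {f : A →ₗ[Λ] B} {g : B →ₗ[Λ] C} {i : ℕ}

lemma zero_iff : ExtVanishes Λ 0 X Y ↔ ∀ f : X →ₗ[Λ] Y, f = 0 := by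
  constructor
  · intro h f
    have := (Ext.mk₀_eq_zero_iff (ModuleCat.ofHom f)).1 (h _)
    simpa using congrArg ModuleCat.Hom.hom this
  · intro h e
    obtain ⟨f, rfl⟩ := (Ext.mk₀_bijective _ _).2 e
    rw [Ext.mk₀_eq_zero_iff]
    ext1
    exact h _

lemma of_projective [Module.Projective Λ X] : ExtVanishes Λ (i + 1) X Y := fun e => by
  have : Projective (ModuleCat.of Λ X) := ModuleCat.projective_of_categoryTheory_projective _
  exact Ext.eq_zero_of_projective e

lemma of_injective (h : Module.Injective Λ Y) : ExtVanishes Λ (i + 1) X Y := fun e => by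
  have : CategoryTheory.Injective (ModuleCat.of Λ Y) :=
    (Module.injective_iff_injective_object Λ Y).1 h
  exact Ext.eq_zero_of_injective e

lemma right_of_isShortExact (h : IsShortExact f g) (hB : ExtVanishes Λ i X B)
    (hA : ExtVanishes Λ (i + 1) X A) : ExtVanishes Λ i X C := fun e => by
  obtain ⟨b, rfl⟩ := Ext.covariant_sequence_exact₃ _ h.shortExact e rfl (hA _)
  rw [hB b, Ext.zero_comp]

lemma left_of_isShortExact (h : IsShortExact f g) (hC : ExtVanishes Λ i X C)
    (hB : ExtVanishes Λ (i + 1) X B) : ExtVanishes Λ (i + 1) X A := fun e => by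
  obtain ⟨c, rfl⟩ := Ext.covariant_sequence_exact₁ _ h.shortExact e (hB _) rfl
  rw [hC c, Ext.zero_comp]

lemma contra_left_of_isShortExact (h : IsShortExact f g) (hB : ExtVanishes Λ i B Y)
    (hC : ExtVanishes Λ (i + 1) C Y) : ExtVanishes Λ i A Y := fun e => by
  obtain ⟨b, rfl⟩ := Ext.contravariant_sequence_exact₁ h.shortExact _ e (add_comm 1 i) (hC _)
  rw [hB b, Ext.comp_zero]

lemma contra_right_of_isShortExact (h : IsShortExact f g) (hA : ExtVanishes Λ i A Y)
    (hB : ExtVanishes Λ (i + 1) B Y) : ExtVanishes Λ (i + 1) C Y := fun e => by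
  obtain ⟨b, rfl⟩ := Ext.contravariant_sequence_exact₃ h.shortExact _ e (hB _) (add_comm 1 i)
  rw [hA b, Ext.comp_zero]

lemma retract_right (s : A →ₗ[Λ] B) (r : B →ₗ[Λ] A) (hrs : r ∘ₗ s = LinearMap.id)
    (h : ExtVanishes Λ i X B) : ExtVanishes Λ i X A := fun e => by
  have : ModuleCat.ofHom s ≫ ModuleCat.ofHom r = 𝟙 _ := by
    rw [← ModuleCat.ofHom_comp, hrs]; rfl
  rw [← e.comp_mk₀_id, ← this, ← Ext.mk₀_comp_mk₀, ← Ext.comp_assoc_of_third_deg_zero,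
    h (e.comp _ _), Ext.zero_comp]

lemma retract_left (s : A →ₗ[Λ] B) (r : B →ₗ[Λ] A) (hrs : r ∘ₗ s = LinearMap.id)
    (h : ExtVanishes Λ i B Y) : ExtVanishes Λ i A Y := fun e => by
  have : ModuleCat.ofHom s ≫ ModuleCat.ofHom r = 𝟙 _ := by
    rw [← ModuleCat.ofHom_comp, hrs]; rfl
  rw [← e.mk₀_id_comp, ← this, ← Ext.mk₀_comp_mk₀_assoc, h ((Ext.mk₀ _).comp e _),
    Ext.comp_zero]

/-- Vanishing of `Ext^i(X, -)` on `Λ` passes to finitely generated projective modules: a dual basis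
writes the identity as a finite sum of maps that factor through `Λ`. -/
lemma right_of_finite_projective [Module.Finite Λ Y] [Module.Projective Λ Y]
    (h : ExtVanishes Λ i X Λ) : ExtVanishes Λ i X Y := by
  obtain ⟨m, r, s, -, -, hrs⟩ := Module.Finite.exists_comp_eq_id_of_projective Λ Y
  refine retract_right s r hrs fun e => ?_
  have hid : (𝟙 (ModuleCat.of Λ (Fin m → Λ))) = ∑ k : Fin m,
      (ModuleCat.ofHom (LinearMap.proj k) ≫
        ModuleCat.ofHom (LinearMap.single Λ (fun _ : Fin m => Λ) k)) := by
    ext1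
    refine LinearMap.ext fun x => ?_
    simpa [ModuleCat.hom_sum, LinearMap.sum_apply] using (Finset.univ_sum_single x).symm
  rw [← e.comp_mk₀_id, hid, Ext.mk₀_sum, Ext.comp_sum]
  refine Finset.sum_eq_zero fun k _ => ?_
  rw [← Ext.mk₀_comp_mk₀, ← Ext.comp_assoc_of_third_deg_zero, h (e.comp _ _), Ext.zero_comp]

/-- If `Ext^1(C, Y) = 0` then maps to `Y` extend along the injection of a short exact sequence
ending in `C`. -/
lemma exists_extension (h : IsShortExact f g) (hC : ExtVanishes Λ 1 C Y) (u : A →ₗ[Λ] Y) :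
    ∃ v : B →ₗ[Λ] Y, v ∘ₗ f = u := by
  obtain ⟨b, hb⟩ := Ext.contravariant_sequence_exact₁ h.shortExact (ModuleCat.of Λ Y)
    (Ext.mk₀ (ModuleCat.ofHom u)) (add_zero 1) (hC _)
  obtain ⟨v, rfl⟩ := (Ext.mk₀_bijective _ _).2 b
  rw [Ext.mk₀_comp_mk₀] at hb
  exact ⟨v.hom, congrArg ModuleCat.Hom.hom ((Ext.mk₀_bijective _ _).1 hb)⟩

lemma one_of_extension (h : IsShortExact f g) (hB : ExtVanishes Λ 1 B Y)
    (H : ∀ u : A →ₗ[Λ] Y, ∃ v : B →ₗ[Λ] Y, v ∘ₗ f = u) : ExtVanishes Λ 1 C Y := fun e => by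
  obtain ⟨a, rfl⟩ := Ext.contravariant_sequence_exact₃ h.shortExact _ e (hB _) (add_zero 1)
  obtain ⟨u, rfl⟩ := (Ext.mk₀_bijective _ _).2 a
  obtain ⟨v, hv⟩ := H u.hom
  have : u = h.toShortComplex.f ≫ ModuleCat.ofHom v := by
    ext x; exact (LinearMap.congr_fun hv x).symm
  rw [this, ← Ext.mk₀_comp_mk₀, ShortComplex.ShortExact.extClass_comp_assoc]

end ExtVanishes

/-! ### Injective dimension -/

section InjectiveDimension

variable {Λ : Type u} [Ring Λ] {M : Type u} [AddCommGroup M] [Module Λ M]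

lemma exists_injective_embedding (Λ : Type u) [Ring Λ] (M : Type u) [AddCommGroup M]
    [Module Λ M] : ∃ (I : ModuleCat.{u} Λ) (f : M →ₗ[Λ] I), Module.Injective Λ I ∧
      Function.Injective f := by
  let ⟨I, _, f, _⟩ := EnoughInjectives.presentation (ModuleCat.of Λ M)
  exact ⟨I, f.hom, (Module.injective_iff_injective_object Λ I).2 ‹_›,
    (ModuleCat.mono_iff_injective f).mp ‹_›⟩

lemma injective_of_extVanishes_one
    (h : ∀ J : Ideal Λ, ExtVanishes Λ 1 (Λ ⧸ J) M) : Module.Injective Λ M := by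
  refine Module.Baer.injective fun J u => ?_
  have hJ : IsShortExact J.subtype J.mkQ :=
    ⟨Subtype.val_injective, J.mkQ_surjective, LinearMap.exact_subtype_mkQ J⟩
  obtain ⟨v, hv⟩ := (h J).exists_extension hJ u
  exact ⟨v, fun x hx => LinearMap.congr_fun hv ⟨x, hx⟩⟩

/-- By Baer's criterion, vanishing of one positive `Ext` group against cyclic modules bounds the
injective dimension. -/
lemma extVanishes_of_cyclic {k : ℕ} : ∀ {M : Type u} [AddCommGroup M] [Module Λ M],
    (∀ J : Ideal Λ, ExtVanishes Λ (k + 1) (Λ ⧸ J) M) →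
    ∀ (X : Type u) [AddCommGroup X] [Module Λ X] (i : ℕ), k + 1 ≤ i → ExtVanishes Λ i X M := by
  induction k with
  | zero =>
    intro M _ _ h X _ _ i hi
    obtain ⟨i, rfl⟩ := Nat.exists_eq_succ_of_ne_zero (by omega : i ≠ 0)
    exact .of_injective (injective_of_extVanishes_one h)
  | succ k ih =>
    intro M _ _ h X _ _ i hi
    obtain ⟨i, rfl⟩ := Nat.exists_eq_succ_of_ne_zero (by omega : i ≠ 0)
    obtain ⟨I, f, hI, hf⟩ := exists_injective_embedding Λ M
    refine .left_of_isShortExact (isShortExact_mkQ f hf) ?_ (.of_injective hI)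
    exact ih (fun J => .right_of_isShortExact (isShortExact_mkQ f hf) (.of_injective hI) (h J))
      X i (by omega)

lemma injectiveDimension_le_iff_extVanishes (n : ℕ) :
    injectiveDimension (ModuleCat.of Λ M) ≤ (n : WithBot ℕ∞) ↔
      ∀ (X : Type u) [AddCommGroup X] [Module Λ X] (i : ℕ), n + 1 ≤ i → ExtVanishes Λ i X M := by
  rw [injectiveDimension_le_iff, HasInjectiveDimensionLE, hasInjectiveDimensionLT_iff]
  exact ⟨fun h X _ _ i hi e => h i hi e, fun h i hi Y e => h Y i hi e⟩

end InjectiveDimension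

/-! ### Retracts and essential submodules -/

section Retracts

variable {Λ : Type u} [Ring Λ] {M N : Type u} [AddCommGroup M] [Module Λ M] [AddCommGroup N]
  [Module Λ N]

lemma injective_of_retract (s : M →ₗ[Λ] N) (r : N →ₗ[Λ] M) (hrs : r ∘ₗ s = LinearMap.id)
    (hN : Module.Injective Λ N) : Module.Injective Λ M :=
  ⟨fun _ _ _ _ _ _ f hf g => by
    obtain ⟨h, hh⟩ := hN.out f hf (s ∘ₗ g)
    exact ⟨r ∘ₗ h, fun x => by simpa [hh] using LinearMap.congr_fun hrs (g x)⟩⟩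

lemma exists_retraction_of_injective (hM : Module.Injective Λ M) (f : M →ₗ[Λ] N)
    (hf : Function.Injective f) : ∃ r : N →ₗ[Λ] M, r ∘ₗ f = LinearMap.id := by
  obtain ⟨r, hr⟩ := hM.out f hf LinearMap.id
  exact ⟨r, LinearMap.ext hr⟩

lemma projective_of_injective_of_embedding (hM : Module.Injective Λ M) [Module.Projective Λ N]
    (f : M →ₗ[Λ] N) (hf : Function.Injective f) : Module.Projective Λ M := by
  obtain ⟨r, hr⟩ := exists_retraction_of_injective hM f hf
  exact Module.Projective.of_split f r hr

lemma IsEssential.injective_of_comp {ι : M →ₗ[Λ] N} (hι : IsEssential (LinearMap.range ι))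
    {Y : Type*} [AddCommGroup Y] [Module Λ Y] (f : N →ₗ[Λ] Y)
    (hf : Function.Injective (f ∘ₗ ι)) : Function.Injective f := by
  refine LinearMap.ker_eq_bot.1 (hι _ (eq_bot_iff.2 ?_))
  rintro _ ⟨⟨x, rfl⟩, hx⟩
  have : x = 0 := hf (by simpa using hx)
  simp [this]

end Retracts

/-! ### Injective hulls -/

section InjectiveHull

variable {Λ : Type u} [Ring Λ]

/-- Every module has an injective hull: inside an injective module, a maximal essential extension
of `M` is a retract. -/
lemma exists_injective_hull (M : Type u) [AddCommGroup M] [Module Λ M] :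
    ∃ (E : ModuleCat.{u} Λ) (ι : M →ₗ[Λ] E), Module.Injective Λ E ∧ Function.Injective ι ∧
      IsEssential (LinearMap.range ι) := by
  obtain ⟨I, f, hI, hf⟩ := exists_injective_embedding Λ M
  set N := LinearMap.range f with hN
  -- `S` is a maximal essential extension of `M` in `I`
  obtain ⟨S, hNS, hS⟩ := zorn_le_nonempty₀
    {S : Submodule Λ I | N ≤ S ∧ ∀ T ≤ S, N ⊓ T = ⊥ → T = ⊥} (fun c hc hchain S₀ hS₀ => by
      refine ⟨sSup c, ⟨(hc hS₀).1.trans (le_sSup hS₀), fun T hT hNT => ?_⟩,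
        fun S hS => le_sSup hS⟩
      refine (Submodule.eq_bot_iff _).2 fun t ht => ?_
      obtain ⟨S, hSc, htS⟩ := (Submodule.mem_sSup_of_directed ⟨S₀, hS₀⟩
        hchain.directedOn).1 (hT ht)
      have : Submodule.span Λ {t} = ⊥ := (hc hSc).2 _ (by simpa using htS)
        (eq_bot_iff.2 ((inf_le_inf_left N (by simpa using ht)).trans hNT.le))
      simpa using this) N
    ⟨le_rfl, fun T hT h => by rwa [inf_eq_right.2 hT] at h⟩
  -- `T` is maximal with `S ⊓ T = ⊥`, so that `S` is essential in `I ⧸ T`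
  obtain ⟨T, -, hT⟩ := zorn_le_nonempty₀ {T : Submodule Λ I | S ⊓ T = ⊥}
    (fun c hc hchain T₀ hT₀ => by
      refine ⟨sSup c, (Submodule.eq_bot_iff _).2 ?_, fun S hS => le_sSup hS⟩
      rintro t ⟨htS, htc⟩
      obtain ⟨T, hTc, htT⟩ := (Submodule.mem_sSup_of_directed ⟨T₀, hT₀⟩
        hchain.directedOn).1 htc
      exact (Submodule.eq_bot_iff _).1 (hc hTc) t ⟨htS, htT⟩) ⊥ (inf_bot_eq _)
  have hST : S ⊓ T = ⊥ := hT.prop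
  have hinj : Function.Injective (T.mkQ ∘ₗ S.subtype) := by
    refine LinearMap.ker_eq_bot.1 ((Submodule.eq_bot_iff _).2 fun x hx => ?_)
    have : (x : I) ∈ S ⊓ T := ⟨x.2, by simpa using hx⟩
    rw [hST] at this
    exact Subtype.ext this
  obtain ⟨g, hg⟩ := hI.out (T.mkQ ∘ₗ S.subtype) hinj S.subtype
  have hess : IsEssential (LinearMap.range (T.mkQ ∘ₗ S.subtype)) := fun U hU => by
    have hTU : T ≤ U.comap T.mkQ := fun t ht => by
      simp [(Submodule.Quotient.mk_eq_zero T).2 ht]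
    have : U.comap T.mkQ ≤ T := by
      refine hT.le_of_ge ?_ hTU
      refine (Submodule.eq_bot_iff _).2 fun x hx => ?_
      have hx0 : T.mkQ x ∈ LinearMap.range (T.mkQ ∘ₗ S.subtype) ⊓ U := ⟨⟨⟨x, hx.1⟩, rfl⟩, hx.2⟩
      rw [hU] at hx0
      have : x ∈ S ⊓ T := ⟨hx.1, by simpa using hx0⟩
      rwa [hST] at this
    refine (Submodule.eq_bot_iff _).2 fun y hy => ?_
    obtain ⟨x, rfl⟩ := T.mkQ_surjective y
    simpa using this hy
  have hginj : Function.Injective g := hess.injective_of_comp g (by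
    have : g ∘ₗ T.mkQ ∘ₗ S.subtype = S.subtype := LinearMap.ext hg
    rw [this]
    exact Subtype.val_injective)
  have hSg : S ≤ LinearMap.range g := fun x hx => ⟨_, hg ⟨x, hx⟩⟩
  -- the image of `I ⧸ T` in `I` is an essential extension of `S`, hence equal to it
  have hgS : LinearMap.range g ≤ S := by
    refine hS.le_of_ge ⟨hNS.trans hSg, fun U hU hNU => ?_⟩ hSg
    have hSU : S ⊓ U = ⊥ := hS.prop.2 _ inf_le_left (by
      rw [← inf_assoc, inf_eq_left.2 hNS]; exact hNU)
    have h0 : U.comap g = ⊥ := hess _ ((Submodule.eq_bot_iff _).2 (by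
      rintro _ ⟨⟨x, rfl⟩, hx⟩
      have : (x : I) ∈ S ⊓ U := ⟨x.2, by
        have h1 : g ((T.mkQ ∘ₗ S.subtype) x) ∈ U := hx
        rwa [hg x] at h1⟩
      rw [hSU] at this
      simp [show x = 0 from Subtype.ext this]))
    rw [← inf_eq_right.2 hU, ← Submodule.map_comap_eq, h0, Submodule.map_bot]
  have hret : (g ∘ₗ T.mkQ).codRestrict S (fun x => hgS ⟨_, rfl⟩) ∘ₗ S.subtype = LinearMap.id :=
    LinearMap.ext fun x => Subtype.ext (hg x)
  refine ⟨ModuleCat.of Λ S, f.codRestrict S fun x => hNS ⟨x, rfl⟩,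
    injective_of_retract S.subtype _ hret hI,
    fun x y hxy => hf (congrArg Subtype.val hxy), fun U hU => ?_⟩
  · have : U.map S.subtype = ⊥ := hS.prop.2 _ (Submodule.map_subtype_le S U) (by
      refine (Submodule.eq_bot_iff _).2 ?_
      rintro _ ⟨⟨x, rfl⟩, y, hy, hyx⟩
      have : y ∈ LinearMap.range (f.codRestrict S fun x => hNS ⟨x, rfl⟩) ⊓ U :=
        ⟨⟨x, Subtype.ext hyx.symm⟩, hy⟩
      rw [hU] at this
      rw [← hyx, show y = 0 from this, map_zero])
    exact Submodule.map_injective_of_injective S.subtype_injective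
      (this.trans (Submodule.map_bot _).symm)

end InjectiveHull

/-! ### Simple submodules and socles -/

section Simple

variable {Λ : Type u} [Ring Λ] {M : Type u} [AddCommGroup M] [Module Λ M]

lemma exists_simple_submodule_le [IsArtinian Λ M] {N : Submodule Λ M} (hN : N ≠ ⊥) :
    ∃ S ≤ N, IsSimpleModule Λ S := by
  have : IsAtomic (Submodule Λ M) := isAtomic_of_orderBot_wellFounded_lt wellFounded_lt
  obtain h | ⟨S, hS, hSN⟩ := IsAtomic.eq_bot_or_exists_atom_le N
  · exact absurd h hN
  · exact ⟨S, hSN, isSimpleModule_iff_isAtom.2 hS⟩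

lemma exists_simple_quotient [Module.Finite Λ M] [Nontrivial M] :
    ∃ N : Submodule Λ M, IsSimpleModule Λ (M ⧸ N) := by
  obtain h | ⟨N, hN, -⟩ := IsCoatomic.eq_top_or_exists_le_coatom (⊥ : Submodule Λ M)
  · exact absurd h bot_ne_top
  · exact ⟨N, isSimpleModule_iff_isCoatom.2 hN⟩

lemma le_socle {S : Submodule Λ M} (hS : IsSimpleModule Λ S) : S ≤ socle Λ M := le_sSup hS

/-- The socle is contained in every essential submodule. -/
lemma IsEssential.socle_le {N : Submodule Λ M} (hN : IsEssential N) : socle Λ M ≤ N := by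
  refine sSup_le fun S hS => ?_
  have hS : IsAtom S := isSimpleModule_iff_isAtom.1 hS
  obtain h | h := hS.le_iff.1 (inf_le_right : N ⊓ S ≤ S)
  · exact absurd (hN S h) hS.1
  · exact inf_eq_right.1 h

end Simple

/-! ### Torsion modules and submodules of free modules -/

section EmbedsInFree

variable {Λ : Type u} [Ring Λ]

/-- The module `N` embeds in a free module `Λ ^ m` of finite rank: membership in `sub Λ`, without
the bundling of finitely generated modules. -/
def EmbedsInFree (Λ : Type u) [Ring Λ] (N : Type u) [AddCommGroup N] [Module Λ N] : Prop :=
  ∃ (m : ℕ) (f : N →ₗ[Λ] (Fin m → Λ)), Function.Injective f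

/-- A module without nonzero maps to `Λ`. -/
def IsTorsion (Λ : Type u) [Ring Λ] (X : Type u) [AddCommGroup X] [Module Λ X] : Prop :=
  ∀ f : X →ₗ[Λ] Λ, f = 0

variable {M N : Type u} [AddCommGroup M] [Module Λ M] [AddCommGroup N] [Module Λ N]

lemma EmbedsInFree.of_embedding (h : EmbedsInFree Λ N) (f : M →ₗ[Λ] N)
    (hf : Function.Injective f) : EmbedsInFree Λ M := by
  obtain ⟨m, g, hg⟩ := h
  exact ⟨m, g ∘ₗ f, hg.comp hf⟩

lemma embedsInFree_of_finite_projective [Module.Finite Λ N] [Module.Projective Λ N] :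
    EmbedsInFree Λ N := by
  obtain ⟨m, r, s, -, hs, -⟩ := Module.Finite.exists_comp_eq_id_of_projective Λ N
  exact ⟨m, s, hs⟩

lemma EmbedsInFree.finite [IsNoetherianRing Λ] (h : EmbedsInFree Λ N) : Module.Finite Λ N := by
  obtain ⟨m, f, hf⟩ := h
  exact Module.Finite.of_injective f hf

/-- A submodule `T` of length at most `d` whose elements are separated from `0` by linear forms on
the ambient module is separated from `0` by `d` of them. -/
lemma exists_pi_map_inf_ker_eq_bot [IsArtinian Λ M] [IsNoetherian Λ M] (d : ℕ) :
    ∀ T : Submodule Λ M, (∀ x ∈ T, x ≠ 0 → ∃ f : M →ₗ[Λ] Λ, f x ≠ 0) → Order.height T ≤ d →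
      ∃ F : M →ₗ[Λ] (Fin d → Λ), T ⊓ LinearMap.ker F = ⊥ := by
  induction d with
  | zero =>
    intro T _ hd
    have : T = ⊥ := by simpa using hd
    exact ⟨0, by simp [this]⟩
  | succ d ih =>
    intro T h hd
    by_cases hT : T = ⊥
    · exact ⟨0, by simp [hT]⟩
    obtain ⟨x, hxT, hx⟩ := (Submodule.ne_bot_iff T).1 hT
    obtain ⟨f, hf⟩ := h x hxT hx
    have hlt : T ⊓ LinearMap.ker f < T :=
      lt_of_le_of_ne inf_le_left fun he => hf (by
        have : x ∈ T ⊓ LinearMap.ker f := by rw [he]; exact hxT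
        exact this.2)
    have hh := Submodule.height_strictMono hlt
    obtain ⟨F, hF⟩ := ih (T ⊓ LinearMap.ker f) (fun y hy => h y hy.1) (by
      have := hh.trans_le hd
      push_cast at this
      exact Order.le_of_lt_add_one this)
    let c : Fin (d + 1) → M →ₗ[Λ] Λ := Fin.cons f fun i => LinearMap.proj i ∘ₗ F
    refine ⟨LinearMap.pi c, (Submodule.eq_bot_iff _).2 fun y hy => ?_⟩
    have hy2 : LinearMap.pi c y = 0 := hy.2
    have h0 : f y = 0 := by simpa [c] using congrFun hy2 0
    have h1 : F y = 0 := by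
      ext i
      simpa [c] using congrFun hy2 i.succ
    have : y ∈ T ⊓ LinearMap.ker f ⊓ LinearMap.ker F := ⟨⟨hy.1, h0⟩, h1⟩
    rwa [hF] at this

lemma embedsInFree_of_separating [IsArtinianRing Λ] [Module.Finite Λ M]
    (h : ∀ x : M, x ≠ 0 → ∃ f : M →ₗ[Λ] Λ, f x ≠ 0) : EmbedsInFree Λ M := by
  obtain ⟨d, hd⟩ := ENat.ne_top_iff_exists.1 (Submodule.height_lt_top (⊤ : Submodule Λ M)).ne
  obtain ⟨F, hF⟩ := exists_pi_map_inf_ker_eq_bot d (⊤ : Submodule Λ M) (fun x _ => h x) hd.ge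
  exact ⟨d, F, LinearMap.ker_eq_bot.1 (by simpa using hF)⟩

lemma exists_linearForm_ne_zero_of_projective [Module.Projective Λ N] {x : N} (hx : x ≠ 0) :
    ∃ f : N →ₗ[Λ] Λ, f x ≠ 0 := by
  obtain ⟨s, hs⟩ := Module.projective_def'.1 (inferInstance : Module.Projective Λ N)
  by_contra! H
  have : s x = 0 := by
    ext i
    exact H (Finsupp.lapply i ∘ₗ s)
  have h2 := LinearMap.congr_fun hs x
  simp [this] at h2
  exact hx h2.symm

lemma IsTorsion.eq_zero_of_projective (hM : IsTorsion Λ M) [Module.Projective Λ N]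
    (g : M →ₗ[Λ] N) : g = 0 := by
  ext x
  by_contra hx
  obtain ⟨f, hf⟩ := exists_linearForm_ne_zero_of_projective (Λ := Λ) hx
  exact hf (LinearMap.congr_fun (hM (f ∘ₗ g)) x)

lemma EmbedsInFree.eq_zero_of_isTorsion (hN : EmbedsInFree Λ N) (hM : IsTorsion Λ M)
    (g : M →ₗ[Λ] N) : g = 0 := by
  obtain ⟨m, f, hf⟩ := hN
  have := hM.eq_zero_of_projective (f ∘ₗ g)
  ext x
  exact hf (by simpa using LinearMap.congr_fun this x)

lemma IsTorsion.of_surjective (hM : IsTorsion Λ M) (g : M →ₗ[Λ] N)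
    (hg : Function.Surjective g) : IsTorsion Λ N := fun f => by
  ext y
  obtain ⟨x, rfl⟩ := hg y
  exact LinearMap.congr_fun (hM (f ∘ₗ g)) x

/-- The hypothesis `domdim Λ ≥ 1`: the regular module embeds in a module that is both projective
and injective. -/
def EmbedsInProjectiveInjective (Λ : Type u) [Ring Λ] : Prop :=
  ∃ (E : ModuleCat.{u} Λ) (ι : Λ →ₗ[Λ] E), Module.Projective Λ E ∧ Module.Injective Λ E ∧
    Function.Injective ι

/-- The common kernel of all linear forms on `M`. It need not satisfy `IsTorsion` itself, unless
`domdim Λ ≥ 1`. -/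
def torsionSubmodule (Λ : Type u) [Ring Λ] (M : Type u) [AddCommGroup M] [Module Λ M] :
    Submodule Λ M :=
  ⨅ f : M →ₗ[Λ] Λ, LinearMap.ker f

lemma mem_torsionSubmodule {x : M} :
    x ∈ torsionSubmodule Λ M ↔ ∀ f : M →ₗ[Λ] Λ, f x = 0 := by
  simp [torsionSubmodule, Submodule.mem_iInf]

/-- If `domdim Λ ≥ 1`, the submodules of the torsion submodule are torsion: a linear form on such a
submodule extends to the ambient module with values in a projective module, whose elements are
separated by linear forms, so that it vanishes. -/
lemma isTorsion_of_le_torsionSubmodule (h : EmbedsInProjectiveInjective Λ) (T : Submodule Λ M)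
    (hT : T ≤ torsionSubmodule Λ M) : IsTorsion Λ T := fun f => by
  obtain ⟨E, ι, hP, hI, hι⟩ := h
  obtain ⟨g, hg⟩ := hI.out T.subtype Subtype.val_injective (ι ∘ₗ f)
  ext x
  apply hι
  by_contra hx
  obtain ⟨φ, hφ⟩ := exists_linearForm_ne_zero_of_projective (Λ := Λ) (x := g x) (by
    simpa using (hg x).trans_ne (by simpa using hx))
  exact hφ (mem_torsionSubmodule.1 (hT x.2) (φ ∘ₗ g))

lemma embedsInFree_of_torsionSubmodule_eq_bot [IsArtinianRing Λ] [Module.Finite Λ M]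
    (h : torsionSubmodule Λ M = ⊥) : EmbedsInFree Λ M :=
  embedsInFree_of_separating fun x hx => by
    by_contra! H
    have := mem_torsionSubmodule.2 H
    rw [h] at this
    exact hx this

lemma torsionSubmodule_quotient_eq_bot :
    torsionSubmodule Λ (M ⧸ torsionSubmodule Λ M) = ⊥ := by
  refine (Submodule.eq_bot_iff _).2 fun y hy => ?_
  obtain ⟨x, rfl⟩ := Submodule.mkQ_surjective _ y
  rw [Submodule.mkQ_apply, Submodule.Quotient.mk_eq_zero, mem_torsionSubmodule]
  intro f
  exact mem_torsionSubmodule.1 hy ((torsionSubmodule Λ M).liftQ f fun z hz =>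
    mem_torsionSubmodule.1 hz f)

/-- If `domdim Λ ≥ 1`, a module whose simple submodules all admit nonzero linear forms embeds in a
free module. -/
lemma embedsInFree_of_simple [IsArtinianRing Λ] (h : EmbedsInProjectiveInjective Λ)
    [Module.Finite Λ M] (hM : ∀ S : Submodule Λ M, IsSimpleModule Λ S → ¬ IsTorsion Λ S) :
    EmbedsInFree Λ M := by
  refine embedsInFree_of_torsionSubmodule_eq_bot ?_
  by_contra hK
  obtain ⟨S, hSK, hS⟩ := exists_simple_submodule_le hK
  exact hM S hS (isTorsion_of_le_torsionSubmodule h S hSK)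

/-- If `domdim Λ ≥ 1`, embedding in a free module is detected on the socle. -/
lemma embedsInFree_iff_socle [IsArtinianRing Λ] (h : EmbedsInProjectiveInjective Λ)
    [Module.Finite Λ M] : EmbedsInFree Λ M ↔ EmbedsInFree Λ (socle Λ M) := by
  refine ⟨fun hM => hM.of_embedding _ (socle Λ M).subtype_injective, fun hs => ?_⟩
  refine embedsInFree_of_simple h fun S hS ht => ?_
  have h0 := hs.eq_zero_of_isTorsion ht (Submodule.inclusion (le_socle hS))
  have : Nontrivial S := IsSimpleModule.nontrivial Λ S
  obtain ⟨x, hx⟩ := exists_ne (0 : S)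
  exact hx (Submodule.inclusion_injective (le_socle hS) (by simp [h0]))

end EmbedsInFree

/-! ### Gorenstein projective modules -/

section TotallyAcyclic

variable {Λ : Type u} [Ring Λ]

/-- A relation that is total in both directions admits two-sided infinite chains through every
element. -/
lemma exists_int_sequence {T : Type*} (R : T → T → Prop) (hnext : ∀ x, ∃ y, R x y)
    (hprev : ∀ y, ∃ x, R x y) (x₀ : T) : ∃ X : ℤ → T, X 0 = x₀ ∧ ∀ i, R (X i) (X (i + 1)) := by
  choose next hnext using hnext
  choose prev hprev using hprev
  refine ⟨fun i => match i with
    | Int.ofNat k => next^[k] x₀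
    | Int.negSucc k => prev^[k + 1] x₀, rfl, fun i => ?_⟩
  match i with
  | Int.ofNat k =>
    change R (next^[k] x₀) (next^[k + 1] x₀)
    rw [Function.iterate_succ_apply']
    exact hnext _
  | Int.negSucc 0 => exact hprev _
  | Int.negSucc (k + 1) =>
    change R (prev^[k + 1 + 1] x₀) (prev^[k + 1] x₀)
    rw [Function.iterate_succ_apply' _ (k + 1)]
    exact hprev _

lemma IsShortExact.exists_factor {A B C Y : Type u} [AddCommGroup A] [Module Λ A]
    [AddCommGroup B] [Module Λ B] [AddCommGroup C] [Module Λ C] [AddCommGroup Y] [Module Λ Y]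
    {f : A →ₗ[Λ] B} {g : B →ₗ[Λ] C} (h : IsShortExact f g) (u : B →ₗ[Λ] Y) (hu : u ∘ₗ f = 0) :
    ∃ v : C →ₗ[Λ] Y, v ∘ₗ g = u := by
  have hk : LinearMap.ker g ≤ LinearMap.ker u := fun x hx => by
    obtain ⟨a, rfl⟩ := (h.exact x).1 hx
    exact LinearMap.congr_fun hu a
  let e := g.quotKerEquivOfSurjective h.surjective
  refine ⟨(LinearMap.ker g).liftQ u hk ∘ₗ e.symm.toLinearMap, LinearMap.ext fun x => ?_⟩
  have : e.symm (g x) = (LinearMap.ker g).mkQ x := by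
    rw [LinearEquiv.symm_apply_eq]
    rfl
  simp [this]

/-- There is a short exact sequence `0 → X → P → Y → 0` with `P` finitely generated projective that
stays exact under `Hom(-, Λ)`. -/
def IsCosyzygy (X Y : ModuleCat.{u} Λ) : Prop :=
  ∃ (P : ModuleCat.{u} Λ) (f : X →ₗ[Λ] P) (g : P →ₗ[Λ] Y), Module.Finite Λ P ∧
    Module.Projective Λ P ∧ IsShortExact f g ∧ ∀ u : X →ₗ[Λ] Λ, ∃ v : P →ₗ[Λ] Λ, v ∘ₗ f = u

/-- A class of modules in which every member has both a cosyzygy and a syzygy consists of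
Gorenstein projective modules: splice the short exact sequences. -/
lemma isGorensteinProjective_of_class (T : ModuleCat.{u} Λ → Prop)
    (hnext : ∀ X, T X → ∃ Y, T Y ∧ IsCosyzygy X Y) (hprev : ∀ Y, T Y → ∃ X, T X ∧ IsCosyzygy X Y)
    (M : ModuleCat.{u} Λ) (hM : T M) : IsGorensteinProjective Λ M := by
  obtain ⟨X, hX0, hX⟩ := exists_int_sequence
    (fun X Y : {X : ModuleCat.{u} Λ // T X} => IsCosyzygy X.1 Y.1)
    (fun X => let ⟨Y, hY, h⟩ := hnext X.1 X.2; ⟨⟨Y, hY⟩, h⟩)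
    (fun Y => let ⟨X, hX, h⟩ := hprev Y.1 Y.2; ⟨⟨X, hX⟩, h⟩) ⟨M, hM⟩
  choose P f g hfin hproj hse hext using hX
  have hker : ∀ i z, f (i + 1) (g i z) = 0 ↔ g i z = 0 := fun i z =>
    map_eq_zero_iff _ (hse (i + 1)).injective
  refine ⟨⟨P, fun i => f (i + 1) ∘ₗ g i, hfin, hproj, fun i z => ?_, fun i u => ?_⟩, ?_⟩
  · change f (i + 1 + 1) (g (i + 1) z) = 0 ↔ _
    rw [hker, (hse (i + 1)).exact z]
    constructor
    · rintro ⟨a, rfl⟩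
      obtain ⟨b, rfl⟩ := (hse i).surjective a
      exact ⟨b, rfl⟩
    · rintro ⟨b, rfl⟩
      exact ⟨g i b, rfl⟩
  · constructor
    · intro hu
      have h1 : u ∘ₗ f (i + 1) = 0 := by
        ext a
        obtain ⟨b, rfl⟩ := (hse i).surjective a
        exact LinearMap.congr_fun hu b
      obtain ⟨v, hv⟩ := (hse (i + 1)).exists_factor u h1
      obtain ⟨w, hw⟩ := hext (i + 1 + 1) v
      exact ⟨w, by dsimp only; rw [← LinearMap.comp_assoc, hw, hv]⟩
    · rintro ⟨w, rfl⟩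
      ext b
      have : g (i + 1) (f (i + 1) (g i b)) = 0 := (hse (i + 1)).exact.apply_apply_eq_zero _
      simp [this]
  · have h0 : LinearMap.ker (f (0 + 1) ∘ₗ g 0) = LinearMap.range (f 0) := by
      ext z
      exact (hker 0 z).trans ((hse 0).exact z)
    have e : M ≃ₗ[Λ] (X 0).1 := by rw [hX0]
    exact ⟨e.trans ((LinearEquiv.ofInjective (f 0) (hse 0).injective).trans
      (LinearEquiv.ofEq _ _ h0.symm))⟩

lemma isGorensteinProjective_of_projective (P : ModuleCat.{u} Λ) (hfin : Module.Finite Λ P)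
    (hproj : Module.Projective Λ P) : IsGorensteinProjective Λ P := by
  have hid : ∀ Q : ModuleCat.{u} Λ, IsShortExact (LinearMap.id : Q →ₗ[Λ] Q)
      (0 : Q →ₗ[Λ] ModuleCat.of Λ PUnit.{u + 1}) := fun Q =>
    ⟨Function.injective_id, fun y => ⟨0, Subsingleton.elim _ _⟩,
      fun y => ⟨fun _ => ⟨y, rfl⟩, fun _ => rfl⟩⟩
  have hid' : ∀ Q : ModuleCat.{u} Λ, IsShortExact (0 : ModuleCat.of Λ PUnit.{u + 1} →ₗ[Λ] Q)
      (LinearMap.id : Q →ₗ[Λ] Q) := fun Q =>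
    ⟨fun _ _ _ => Subsingleton.elim _ _, Function.surjective_id,
      fun y => ⟨fun h => ⟨0, h.symm⟩, fun ⟨_, h⟩ => h.symm⟩⟩
  refine isGorensteinProjective_of_class (fun X => Module.Finite Λ X ∧ Module.Projective Λ X)
    (fun X hX => ⟨ModuleCat.of Λ PUnit, ⟨inferInstanceAs (Module.Finite Λ PUnit.{u + 1}),
      inferInstanceAs (Module.Projective Λ PUnit.{u + 1})⟩, X, _, _, hX.1, hX.2, hid X,
        fun u => ⟨u, rfl⟩⟩)
    (fun Y hY => ⟨ModuleCat.of Λ PUnit, ⟨inferInstanceAs (Module.Finite Λ PUnit.{u + 1}),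
      inferInstanceAs (Module.Projective Λ PUnit.{u + 1})⟩, Y, _, _, hY.1, hY.2, hid' Y,
        fun u => ⟨0, LinearMap.ext fun x => ?_⟩⟩) P ⟨hfin, hproj⟩
  rw [Subsingleton.elim x 0, map_zero, map_zero]

variable (C : TotallyAcyclicComplex Λ)

/-- The cocycles of a totally acyclic complex form short exact sequences. -/
lemma TotallyAcyclicComplex.isShortExact (j : ℤ) :
    IsShortExact (LinearMap.ker (C.d j)).subtype
      ((C.d j).codRestrict (LinearMap.ker (C.d (j + 1)))
        fun x => (C.exact j).apply_apply_eq_zero x) := by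
  refine ⟨Subtype.val_injective, fun y => ?_, fun x => ?_⟩
  · obtain ⟨x, hx⟩ := (C.exact j y).1 y.2
    exact ⟨x, Subtype.ext hx⟩
  · refine ⟨fun hx => ⟨⟨x, congrArg Subtype.val hx⟩, rfl⟩, ?_⟩
    rintro ⟨y, rfl⟩
    exact Subtype.ext y.2

/-- A linear form on cocycles extends, because its composition with the preceding differential is
a cocycle of the dual complex. -/
lemma TotallyAcyclicComplex.extVanishes_one (j : ℤ) :
    ExtVanishes Λ 1 (LinearMap.ker (C.d j)) Λ := by
  obtain ⟨i, rfl⟩ : ∃ i, j = i + 1 + 1 + 1 := ⟨j - 3, by ring⟩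
  have := C.projective (i + 1 + 1)
  refine .one_of_extension (C.isShortExact (i + 1 + 1)) .of_projective fun u => ?_
  let p := (C.d (i + 1)).codRestrict (LinearMap.ker (C.d (i + 1 + 1)))
    fun x => (C.exact (i + 1)).apply_apply_eq_zero x
  have hp : Function.Surjective p := (C.isShortExact (i + 1)).surjective
  obtain ⟨v, hv⟩ := (C.hom_exact i (u ∘ₗ p)).1 (LinearMap.ext fun x => by
    have : p (C.d i x) = 0 := Subtype.ext ((C.exact i).apply_apply_eq_zero x)
    simp [this])
  refine ⟨v, LinearMap.ext fun y => ?_⟩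
  obtain ⟨x, rfl⟩ := hp y
  exact LinearMap.congr_fun hv x

lemma TotallyAcyclicComplex.extVanishes (i : ℕ) :
    ∀ j : ℤ, ExtVanishes Λ (i + 1) (LinearMap.ker (C.d j)) Λ := by
  induction i with
  | zero => exact C.extVanishes_one
  | succ i ih =>
    intro j
    obtain ⟨j, rfl⟩ : ∃ k, j = k + 1 := ⟨j - 1, by ring⟩
    have := C.projective j
    exact .contra_right_of_isShortExact (C.isShortExact j) (ih j) .of_projective

/-- Modules `X` with `Ext^i(X, Λ) = 0` for `i ≤ n` satisfy the same against cocycles of totally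
acyclic complexes: every such cocycle module embeds in a projective with cokernel of the same
kind. -/
lemma TotallyAcyclicComplex.extVanishes_right {X : Type u} [AddCommGroup X] [Module Λ X] {n : ℕ}
    (hX : ∀ i ≤ n, ExtVanishes Λ i X Λ) : ∀ i ≤ n, ∀ j : ℤ,
      ExtVanishes Λ i X (LinearMap.ker (C.d j)) := by
  have hP : ∀ i ≤ n, ∀ j : ℤ, ExtVanishes Λ i X (C.P j) := fun i hi j => by
    have := C.projective j
    have := C.finite j
    exact (hX i hi).right_of_finite_projective
  intro i
  induction i with
  | zero =>
    intro hi j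
    rw [ExtVanishes.zero_iff]
    intro f
    have h0 := ExtVanishes.zero_iff.1 (hP 0 hi j) ((LinearMap.ker (C.d j)).subtype ∘ₗ f)
    exact LinearMap.ext fun x => Subtype.ext (LinearMap.congr_fun h0 x)
  | succ i ih =>
    intro hi j
    exact .left_of_isShortExact (C.isShortExact j) (ih (by omega) (j + 1)) (hP (i + 1) hi j)

variable {M : Type u} [AddCommGroup M] [Module Λ M]

lemma IsGorensteinProjective.extVanishes (h : IsGorensteinProjective Λ M) (i : ℕ) :
    ExtVanishes Λ (i + 1) M Λ := by
  obtain ⟨C, ⟨e⟩⟩ := h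
  exact (C.extVanishes i 0).retract_left e.toLinearMap e.symm.toLinearMap (by ext; simp)

lemma IsGorensteinProjective.extVanishes_right (h : IsGorensteinProjective Λ M) {X : Type u}
    [AddCommGroup X] [Module Λ X] {n : ℕ} (hX : ∀ i ≤ n, ExtVanishes Λ i X Λ) (i : ℕ)
    (hi : i ≤ n) : ExtVanishes Λ i X M := by
  obtain ⟨C, ⟨e⟩⟩ := h
  exact (C.extVanishes_right hX i hi 0).retract_right e.toLinearMap e.symm.toLinearMap
    (by ext; simp)

lemma IsGorensteinProjective.of_equiv (h : IsGorensteinProjective Λ M) {N : Type u}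
    [AddCommGroup N] [Module Λ N] (e : N ≃ₗ[Λ] M) : IsGorensteinProjective Λ N := by
  obtain ⟨C, ⟨e'⟩⟩ := h
  exact ⟨C, ⟨e.trans e'⟩⟩

end TotallyAcyclic

/-! ### Gorenstein projective dimension -/

section GorensteinDimension

variable {Λ : Type u} [Ring Λ]

/-- The recursive form of "Gorenstein projective dimension at most `n`": Gorenstein projective for
`n = 0`, and a quotient of a Gorenstein projective module with kernel of dimension at most `n - 1`
otherwise. -/
def HasGpdLE : ℕ → ModuleCat.{u} Λ → Prop
  | 0, M => IsGorensteinProjective Λ M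
  | n + 1, M => ∃ (K G : ModuleCat.{u} Λ) (f : K →ₗ[Λ] G) (g : G →ₗ[Λ] M),
      IsShortExact f g ∧ IsGorensteinProjective Λ G ∧ HasGpdLE n K

/-- The tail of a resolution resolves the kernel of the augmentation. -/
def GorensteinProjectiveResolution.tail {M : Type u} [AddCommGroup M] [Module Λ M]
    (r : GorensteinProjectiveResolution Λ M) :
    GorensteinProjectiveResolution Λ (LinearMap.ker r.ε) where
  G i := r.G (i + 1)
  d i := r.d (i + 1)
  ε := (r.d 0).codRestrict _ fun x => r.exact_zero.apply_apply_eq_zero x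
  gorensteinProjective i := r.gorensteinProjective (i + 1)
  surjective y := by
    obtain ⟨x, hx⟩ := (r.exact_zero y).1 y.2
    exact ⟨x, Subtype.ext hx⟩
  exact_zero x := by
    rw [← r.exact_succ 0 x]
    exact Subtype.ext_iff
  exact_succ i := r.exact_succ (i + 1)

lemma hasGpdLE_of_resolution (n : ℕ) : ∀ {M : Type u} [AddCommGroup M] [Module Λ M]
    (r : GorensteinProjectiveResolution Λ M), (∀ i, n < i → Subsingleton (r.G i)) →
      HasGpdLE n (ModuleCat.of Λ M) := by
  induction n with
  | zero =>
    intro M _ _ r hr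
    have := hr 1 one_pos
    have hinj : Function.Injective r.ε := by
      refine (injective_iff_map_eq_zero _).2 fun x hx => ?_
      obtain ⟨y, rfl⟩ := (r.exact_zero x).1 hx
      rw [show y = 0 from Subsingleton.elim (α := r.G 1) _ _, map_zero]
    exact (r.gorensteinProjective 0).of_equiv
      (LinearEquiv.ofBijective r.ε ⟨hinj, r.surjective⟩).symm
  | succ n ih =>
    intro M _ _ r hr
    exact ⟨ModuleCat.of Λ (LinearMap.ker r.ε), r.G 0, _, _, isShortExact_ker r.ε r.surjective,
      r.gorensteinProjective 0, ih r.tail fun i hi => hr (i + 1) (by omega)⟩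

/-- Prolong a resolution of `K` along a short exact sequence `0 → K → G → M → 0`. -/
def GorensteinProjectiveResolution.cons {K G M : ModuleCat.{u} Λ} {f : K →ₗ[Λ] G} {g : G →ₗ[Λ] M}
    (h : IsShortExact f g) (hG : IsGorensteinProjective Λ G)
    (r : GorensteinProjectiveResolution Λ K) : GorensteinProjectiveResolution Λ M where
  G i := match i with
    | 0 => G
    | i + 1 => r.G i
  d i := match i with
    | 0 => f ∘ₗ r.ε
    | i + 1 => r.d i
  ε := g
  gorensteinProjective i := match i with
    | 0 => hG
    | i + 1 => r.gorensteinProjective i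
  surjective := h.surjective
  exact_zero x := by
    rw [h.exact x]
    constructor
    · rintro ⟨y, rfl⟩
      obtain ⟨z, rfl⟩ := r.surjective y
      exact ⟨z, rfl⟩
    · rintro ⟨z, rfl⟩
      exact ⟨r.ε z, rfl⟩
  exact_succ i := match i with
    | 0 => fun x => by
      rw [← r.exact_zero x]
      exact map_eq_zero_iff f h.injective
    | i + 1 => r.exact_succ i

lemma exists_resolution_of_hasGpdLE (n : ℕ) : ∀ M : ModuleCat.{u} Λ, HasGpdLE n M →
    ∃ r : GorensteinProjectiveResolution Λ M, ∀ i, n < i → Subsingleton (r.G i) := by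
  induction n with
  | zero =>
    intro M hM
    refine ⟨⟨fun i => match i with
      | 0 => M
      | _ + 1 => ModuleCat.of Λ PUnit, fun i => 0, LinearMap.id, fun i => match i with
        | 0 => hM
        | _ + 1 => isGorensteinProjective_of_projective _
          (inferInstanceAs (Module.Finite Λ PUnit.{u + 1}))
          (inferInstanceAs (Module.Projective Λ PUnit.{u + 1})),
      Function.surjective_id, fun x => ⟨fun h => ⟨0, by simpa using h.symm⟩, ?_⟩,
      fun i x => ⟨fun _ => ⟨0, Subsingleton.elim (α := PUnit) _ _⟩, fun _ => rfl⟩⟩, ?_⟩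
    · rintro ⟨y, rfl⟩
      rfl
    · rintro (_ | i) hi
      · omega
      · exact inferInstanceAs (Subsingleton PUnit.{u + 1})
  | succ n ih =>
    rintro M ⟨K, G, f, g, h, hG, hK⟩
    obtain ⟨r, hr⟩ := ih K hK
    refine ⟨r.cons h hG, ?_⟩
    rintro (_ | i) hi
    · omega
    · exact hr i (by omega)

lemma gpd_le_iff {M : Type u} [AddCommGroup M] [Module Λ M] {n : ℕ} :
    gpd Λ M ≤ n ↔ HasGpdLE n (ModuleCat.of Λ M) := by
  constructor
  · intro h
    obtain ⟨m, ⟨r, hr⟩, hm⟩ := sInf_lt_iff.1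
      (lt_of_le_of_lt h (by exact_mod_cast Nat.lt_succ_self n : (n : ℕ∞) < (n + 1 : ℕ)))
    refine hasGpdLE_of_resolution n r fun i hi => hr i (hm.trans_le ?_)
    exact_mod_cast hi
  · intro h
    obtain ⟨r, hr⟩ := exists_resolution_of_hasGpdLE n _ h
    exact sInf_le ⟨r, fun i hi => hr i (by exact_mod_cast hi)⟩

/-- Dimension shifting along a resolution: `Ext^i(M, Λ) = 0` for `i > Gpd M`. -/
lemma HasGpdLE.extVanishes (n : ℕ) : ∀ {M : ModuleCat.{u} Λ}, HasGpdLE n M →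
    ∀ i, n < i → ExtVanishes Λ i M Λ := by
  induction n with
  | zero =>
    intro M h i hi
    obtain ⟨i, rfl⟩ := Nat.exists_eq_succ_of_ne_zero (by omega : i ≠ 0)
    exact IsGorensteinProjective.extVanishes h i
  | succ n ih =>
    rintro M ⟨K, G, f, g, h, hG, hK⟩ i hi
    obtain ⟨i, rfl⟩ := Nat.exists_eq_succ_of_ne_zero (by omega : i ≠ 0)
    exact .contra_right_of_isShortExact h (ih hK i (by omega)) (hG.extVanishes i)

/-- If `Ext^i(X, Λ) = 0` for `i ≤ n`, then `Ext^i(X, M) = 0` for `i + Gpd M ≤ n`. -/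
lemma HasGpdLE.extVanishes_right {X : Type u} [AddCommGroup X] [Module Λ X] {n : ℕ}
    (hX : ∀ i ≤ n, ExtVanishes Λ i X Λ) (k : ℕ) : ∀ {M : ModuleCat.{u} Λ}, HasGpdLE k M →
    ∀ i, i + k ≤ n → ExtVanishes Λ i X M := by
  induction k with
  | zero => exact fun h i hi => IsGorensteinProjective.extVanishes_right h hX i hi
  | succ k ih =>
    rintro M ⟨K, G, f, g, h, hG, hK⟩ i hi
    exact .right_of_isShortExact h (hG.extVanishes_right hX i (by omega))
      (ih hK (i + 1) (by omega))

end GorensteinDimension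

/-! ### Projective covers of simple modules -/

section LocalCover

variable {Λ : Type u} [Ring Λ]

/-- A surjection `π : P → S` whose kernel contains every proper submodule of `P`. For `P` finitely
generated projective and `S` simple this is a projective cover. -/
structure IsLocalCover {P S : Type u} [AddCommGroup P] [Module Λ P] [AddCommGroup S] [Module Λ S]
    (π : P →ₗ[Λ] S) : Prop where
  surjective : Function.Surjective π
  le_ker : ∀ L : Submodule Λ P, L ≠ ⊤ → L ≤ LinearMap.ker π

/-- Projective covers of simple modules exist over an artinian ring, and are direct summands of
`Λ`: by Fitting's lemma, a minimal summand of `Λ` that maps onto `S` is local. -/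
lemma exists_isLocalCover [IsArtinianRing Λ] (S : Type u) [AddCommGroup S] [Module Λ S]
    [IsSimpleModule Λ S] : ∃ (P : Submodule Λ Λ) (r : Λ →ₗ[Λ] P) (π : P →ₗ[Λ] S),
      r ∘ₗ P.subtype = LinearMap.id ∧ IsLocalCover π := by
  have : Nontrivial S := IsSimpleModule.nontrivial Λ S
  obtain ⟨x₀, hx₀⟩ := exists_ne (0 : S)
  obtain ⟨P, ⟨r, hr, π, hπ⟩, hmin⟩ := IsArtinian.set_has_minimal
    {L : Submodule Λ Λ | ∃ r : Λ →ₗ[Λ] L, r ∘ₗ L.subtype = LinearMap.id ∧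
      ∃ π : L →ₗ[Λ] S, Function.Surjective π}
    ⟨⊤, Submodule.topEquiv.symm.toLinearMap, by ext; rfl,
      LinearMap.toSpanSingleton Λ S x₀ ∘ₗ Submodule.topEquiv.toLinearMap,
      (IsSimpleModule.toSpanSingleton_surjective Λ hx₀).comp Submodule.topEquiv.surjective⟩
  refine ⟨P, r, π, hr, hπ, fun L hL => ?_⟩
  by_contra hLker
  apply hL
  have hproj : Module.Projective Λ P := Module.Projective.of_split P.subtype r hr
  have hne : π ∘ₗ L.subtype ≠ 0 := fun h0 => hLker fun x hx => LinearMap.congr_fun h0 ⟨x, hx⟩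
  obtain ⟨h, hh⟩ := Module.projective_lifting_property (π ∘ₗ L.subtype) π
    (LinearMap.surjective_of_ne_zero hne)
  let φ : Module.End Λ P := L.subtype ∘ₗ h
  have hφ : ∀ x, π (φ x) = π x := LinearMap.congr_fun hh
  have hφk : ∀ k x, π ((φ ^ k) x) = π x := by
    intro k
    induction k with
    | zero => simp
    | succ k ih => intro x; rw [pow_succ', Module.End.mul_apply, hφ, ih]
  obtain ⟨k, hk, hk1⟩ := (φ.eventually_isCompl_ker_pow_range_pow.and
    (Filter.eventually_ge_atTop 1)).exists
  let R := LinearMap.range (φ ^ k)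
  have hRL : R ≤ L := by
    rintro _ ⟨x, rfl⟩
    obtain ⟨k, rfl⟩ := Nat.exists_eq_succ_of_ne_zero (by omega : k ≠ 0)
    rw [Nat.succ_eq_add_one, pow_succ', Module.End.mul_apply]
    exact (h _).2
  obtain ⟨p, hp⟩ : ∃ p : P →ₗ[Λ] R, p ∘ₗ R.subtype = LinearMap.id :=
    ⟨R.projectionOnto _ hk.symm, LinearMap.ext fun x => Submodule.projectionOnto_apply_left _ x⟩
  let e := P.equivSubtypeMap R
  have hmem : R.map P.subtype = P := by
    have hle : R.map P.subtype ≤ P := Submodule.map_subtype_le P R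
    refine (lt_or_eq_of_le hle).resolve_left (hmin _ ⟨e.toLinearMap ∘ₗ p ∘ₗ r, ?_,
      π ∘ₗ R.subtype ∘ₗ e.symm.toLinearMap, fun s => ?_⟩)
    · refine LinearMap.ext fun y => ?_
      obtain ⟨y, rfl⟩ := e.surjective y
      have h1 : r ((e y : R.map P.subtype) : Λ) = y := LinearMap.congr_fun hr (y : P)
      have h2 : p y = y := LinearMap.congr_fun hp y
      simp [h1, h2]
    · obtain ⟨x, rfl⟩ := hπ s
      exact ⟨e ⟨(φ ^ k) x, x, rfl⟩, by simp [hφk]⟩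
  refine eq_top_iff.2 fun x _ => hRL ?_
  have : (x : Λ) ∈ R.map P.subtype := by rw [hmem]; exact x.2
  obtain ⟨y, hy, hyx⟩ := this
  rwa [← show y = x from Subtype.ext hyx]

section

variable {P₁ S₁ P₂ S₂ : Type u} [AddCommGroup P₁] [Module Λ P₁] [AddCommGroup S₁]
  [Module Λ S₁] [AddCommGroup P₂] [Module Λ P₂] [AddCommGroup S₂] [Module Λ S₂]
  [IsSimpleModule Λ S₁] [IsSimpleModule Λ S₂] {π₁ : P₁ →ₗ[Λ] S₁} {π₂ : P₂ →ₗ[Λ] S₂}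

/-- A module with a local cover has only one simple quotient. -/
lemma IsLocalCover.nonempty_equiv (h₂ : IsLocalCover π₂) (q : P₂ →ₗ[Λ] S₁)
    (hq : Function.Surjective q) : Nonempty (S₁ ≃ₗ[Λ] S₂) := by
  have : Nontrivial S₁ := IsSimpleModule.nontrivial Λ S₁
  have : Nontrivial S₂ := IsSimpleModule.nontrivial Λ S₂
  have hker : LinearMap.ker q ≠ ⊤ := fun h => by
    obtain ⟨y, hy⟩ := exists_ne (0 : S₁)
    obtain ⟨x, rfl⟩ := hq y
    exact hy (LinearMap.mem_ker.1 (h ▸ Submodule.mem_top))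
  obtain ⟨t, ht⟩ := (isShortExact_ker q hq).exists_factor π₂
    (LinearMap.ext fun x => h₂.le_ker _ hker x.2)
  have ht0 : t ≠ 0 := by
    rintro rfl
    obtain ⟨y, hy⟩ := exists_ne (0 : S₂)
    obtain ⟨x, rfl⟩ := h₂.surjective y
    exact hy (LinearMap.congr_fun ht x).symm
  exact ⟨LinearEquiv.ofBijective t (LinearMap.bijective_of_ne_zero ht0)⟩

/-- An endomorphism of a local module that factors through the projective cover of a different
simple module is nilpotent. -/
lemma IsLocalCover.exists_pow_eq_zero [IsArtinian Λ P₁] (h₁ : IsLocalCover π₁)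
    (h₂ : IsLocalCover π₂) (hne : IsEmpty (S₁ ≃ₗ[Λ] S₂)) (u : P₁ →ₗ[Λ] P₂) (v : P₂ →ₗ[Λ] P₁) :
    ∃ k, (v ∘ₗ u : Module.End Λ P₁) ^ k = 0 := by
  have : Nontrivial S₁ := IsSimpleModule.nontrivial Λ S₁
  let w : Module.End Λ P₁ := v ∘ₗ u
  obtain ⟨k, hk, hk1⟩ := (w.eventually_codisjoint_ker_pow_range_pow.and
    (Filter.eventually_ge_atTop 1)).exists
  refine ⟨k, LinearMap.ker_eq_top.1 ?_⟩
  by_contra hker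
  have hv : LinearMap.range v ≠ ⊤ := fun hv => hne.elim
    (h₂.nonempty_equiv (π₁ ∘ₗ v) (h₁.surjective.comp (LinearMap.range_eq_top.1 hv))).some
  have hrange : LinearMap.range (w ^ k) ≤ LinearMap.range v := by
    rintro _ ⟨x, rfl⟩
    obtain ⟨k, rfl⟩ := Nat.exists_eq_succ_of_ne_zero (by omega : k ≠ 0)
    rw [Nat.succ_eq_add_one, pow_succ', Module.End.mul_apply]
    exact ⟨_, rfl⟩
  have htop : (⊤ : Submodule Λ P₁) ≤ LinearMap.ker π₁ := by
    rw [← hk.eq_top]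
    exact sup_le (h₁.le_ker _ hker) (hrange.trans (h₁.le_ker _ hv))
  obtain ⟨y, hy⟩ := exists_ne (0 : S₁)
  obtain ⟨x, rfl⟩ := h₁.surjective y
  exact hy (htop Submodule.mem_top)

end

end LocalCover

/-! ### Finiteness of the set of simple modules -/

section FinitelyManySimples

variable {Λ : Type u} [Ring Λ]

/-- A simple quotient of `Λ` by a maximal left ideal that contains a finite intersection of maximal
left ideals is isomorphic to the quotient by one of these. -/
lemma exists_equiv_of_inf_le {ι : Type*} (I : ι → Ideal Λ) (hI : ∀ i, IsCoatom (I i))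
    (m : Ideal Λ) (hm : IsCoatom m) (s : Finset ι) (h : s.inf I ≤ m) :
    ∃ i ∈ s, Nonempty ((Λ ⧸ I i) ≃ₗ[Λ] (Λ ⧸ m)) := by
  classical
  induction s using Finset.induction_on with
  | empty => exact absurd (top_le_iff.1 (by simpa using h)) hm.1
  | insert a s _ ih =>
    by_cases hs : s.inf I ≤ m
    · obtain ⟨i, hi, e⟩ := ih hs
      exact ⟨i, Finset.mem_insert_of_mem hi, e⟩
    refine ⟨a, Finset.mem_insert_self a s, ?_⟩
    rw [Finset.inf_insert] at h
    have : IsSimpleModule Λ (Λ ⧸ m) := isSimpleModule_iff_isCoatom.2 hm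
    have : IsSimpleModule Λ (Λ ⧸ I a) := isSimpleModule_iff_isCoatom.2 (hI a)
    let q := (I a).mkQ ∘ₗ (s.inf I).subtype
    let t := m.mkQ ∘ₗ (s.inf I).subtype
    have ht : t ≠ 0 := fun h0 => hs fun x hx =>
      (Submodule.Quotient.mk_eq_zero m).1 (LinearMap.congr_fun h0 ⟨x, hx⟩)
    have hq : q ≠ 0 := fun h0 => hs fun x hx => h
      ⟨(Submodule.Quotient.mk_eq_zero (I a)).1 (LinearMap.congr_fun h0 ⟨x, hx⟩), hx⟩
    obtain ⟨v, hv⟩ := (isShortExact_ker q (LinearMap.surjective_of_ne_zero hq)).exists_factor t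
      (LinearMap.ext fun x => (Submodule.Quotient.mk_eq_zero m).2
        (h ⟨(Submodule.Quotient.mk_eq_zero (I a)).1 x.2, x.1.2⟩))
    have hv0 : v ≠ 0 := by
      rintro rfl
      exact ht (by rw [← hv, LinearMap.zero_comp])
    exact ⟨LinearEquiv.ofBijective v (LinearMap.bijective_of_ne_zero hv0)⟩

/-- Over an artinian ring there is a finite irredundant list of the simple modules. -/
lemma exists_finite_simples (Λ : Type u) [Ring Λ] [IsArtinianRing Λ] :
    ∃ (ι : Type u) (_ : Finite ι) (S : ι → ModuleCat.{u} Λ), (∀ i, IsSimpleModule Λ (S i)) ∧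
      (∀ i j, Nonempty (S i ≃ₗ[Λ] S j) → i = j) ∧
      ∀ (T : Type u) [AddCommGroup T] [Module Λ T] [IsSimpleModule Λ T],
        ∃ i, Nonempty (T ≃ₗ[Λ] S i) := by
  let st : Setoid {m : Ideal Λ // IsCoatom m} :=
    ⟨fun a b => Nonempty ((Λ ⧸ a.1) ≃ₗ[Λ] (Λ ⧸ b.1)),
      fun _ => ⟨LinearEquiv.refl _ _⟩, fun ⟨e⟩ => ⟨e.symm⟩, fun ⟨e⟩ ⟨f⟩ => ⟨e.trans f⟩⟩
  refine ⟨Quotient st, ?_, fun q => ModuleCat.of Λ (Λ ⧸ q.out.1),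
    fun q => isSimpleModule_iff_isCoatom.2 q.out.2, fun p q h => ?_, fun T _ _ _ => ?_⟩
  · obtain ⟨s, hs⟩ := Finset.exists_inf_le (Subtype.val : {m : Ideal Λ // IsCoatom m} → Ideal Λ)
    refine Finite.of_surjective (fun i : s => (Quotient.mk st i.1)) fun q => ?_
    induction q using Quotient.inductionOn with
    | _ m =>
      obtain ⟨i, hi, e⟩ := exists_equiv_of_inf_le _ (fun i => i.2) m.1 m.2 s (hs m)
      exact ⟨⟨i, hi⟩, Quotient.sound e⟩
  · rw [← Quotient.out_eq p, ← Quotient.out_eq q]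
    exact Quotient.sound h
  · obtain ⟨m, hm, ⟨e⟩⟩ := isSimpleModule_iff_quot_maximal.1 ‹IsSimpleModule Λ T›
    refine ⟨Quotient.mk st ⟨m, Ideal.isMaximal_def.1 hm⟩, ?_⟩
    obtain ⟨f⟩ := Quotient.mk_out (s := st) ⟨m, Ideal.isMaximal_def.1 hm⟩
    exact ⟨e.trans f.symm⟩

end FinitelyManySimples

/-! ### Coresolutions by projective-injective modules -/

section Coresolution

variable {Λ : Type u} [Ring Λ]

/-- The module `M` has a coresolution `0 → M → I_0 → ⋯ → I_{k-1} → C → 0` with all `I_j` projective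
and injective and with `C` injective. -/
def HasProjInjCoresolution : ℕ → ModuleCat.{u} Λ → Prop
  | 0, M => Module.Injective Λ M
  | k + 1, M => ∃ (I C : ModuleCat.{u} Λ) (f : M →ₗ[Λ] I) (g : I →ₗ[Λ] C),
      IsShortExact f g ∧ Module.Projective Λ I ∧ Module.Injective Λ I ∧ HasProjInjCoresolution k C

lemma MinimalInjectiveCoresolution.hasProjInjCoresolution_ker {M : Type u} [AddCommGroup M]
    [Module Λ M] (r : MinimalInjectiveCoresolution Λ M) (n : ℕ)
    (hr : ∀ j < n, Module.Projective Λ (r.I j)) (k : ℕ) : ∀ j, k + j = n →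
      (∀ (Y : Type u) [AddCommGroup Y] [Module Λ Y],
        ExtVanishes Λ (k + 1) Y (LinearMap.ker (r.d j))) →
      HasProjInjCoresolution k (ModuleCat.of Λ (LinearMap.ker (r.d j))) := by
  induction k with
  | zero => exact fun j _ h => injective_of_extVanishes_one fun J => h _
  | succ k ih =>
    intro j hj h
    have hse : IsShortExact (LinearMap.ker (r.d j)).subtype
        ((r.d j).codRestrict (LinearMap.ker (r.d (j + 1)))
          fun x => (r.exact_succ j).apply_apply_eq_zero x) := by
      refine ⟨Subtype.val_injective, fun y => ?_, fun x => ?_⟩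
      · obtain ⟨x, hx⟩ := (r.exact_succ j y).1 y.2
        exact ⟨x, Subtype.ext hx⟩
      · refine ⟨fun hx => ⟨⟨x, congrArg Subtype.val hx⟩, rfl⟩, ?_⟩
        rintro ⟨y, rfl⟩
        exact Subtype.ext y.2
    exact ⟨r.I j, ModuleCat.of Λ (LinearMap.ker (r.d (j + 1))), _, _, hse, hr j (by omega),
      r.injective_module j, ih (j + 1) (by omega) fun Y _ _ =>
        .right_of_isShortExact hse (.of_injective (r.injective_module j)) (h Y)⟩

lemma HasProjInjCoresolution.of_equiv {k : ℕ} {M N : ModuleCat.{u} Λ}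
    (h : HasProjInjCoresolution k M) (e : N ≃ₗ[Λ] M) : HasProjInjCoresolution k N := by
  cases k with
  | zero => exact injective_of_retract e.toLinearMap e.symm.toLinearMap (by ext; simp) h
  | succ k =>
    obtain ⟨I, C, f, g, hse, hP, hI, hC⟩ := h
    refine ⟨I, C, f ∘ₗ e.toLinearMap, g, ⟨hse.injective.comp e.injective, hse.surjective,
      fun x => ?_⟩, hP, hI, hC⟩
    rw [hse.exact x]
    exact ⟨fun ⟨y, hy⟩ => ⟨e.symm y, by simpa using hy⟩, fun ⟨y, hy⟩ => ⟨e y, hy⟩⟩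

lemma MinimalInjectiveCoresolution.hasProjInjCoresolution {M : Type u} [AddCommGroup M]
    [Module Λ M] (r : MinimalInjectiveCoresolution Λ M) (n : ℕ)
    (hr : ∀ j < n, Module.Projective Λ (r.I j))
    (h : ∀ (Y : Type u) [AddCommGroup Y] [Module Λ Y], ExtVanishes Λ (n + 1) Y M) :
    HasProjInjCoresolution n (ModuleCat.of Λ M) := by
  have hrange : LinearMap.range r.ι = LinearMap.ker (r.d 0) := by
    ext x
    exact (r.exact_zero x).symm
  let e : M ≃ₗ[Λ] LinearMap.ker (r.d 0) :=
    (LinearEquiv.ofInjective r.ι r.injective_ι).trans (LinearEquiv.ofEq _ _ hrange)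
  exact (r.hasProjInjCoresolution_ker n hr n 0 (by omega) fun Y _ _ =>
    (h Y).retract_right e.symm.toLinearMap e.toLinearMap (by ext; simp)).of_equiv e

/-- Torsion modules have no extensions by `M` in degrees where the coresolution of `M` is
projective. -/
lemma HasProjInjCoresolution.extVanishes {X : Type u} [AddCommGroup X] [Module Λ X]
    (hX : IsTorsion Λ X) (k : ℕ) : ∀ {M : ModuleCat.{u} Λ}, HasProjInjCoresolution k M →
      ∀ i < k, ExtVanishes Λ i X M := by
  induction k with
  | zero => intro M _ i hi; omega
  | succ k ih =>
    rintro M ⟨I, C, f, g, hse, hP, hI, hC⟩ i hi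
    cases i with
    | zero =>
      rw [ExtVanishes.zero_iff]
      intro u
      have := hX.eq_zero_of_projective (f ∘ₗ u)
      ext x
      exact hse.injective (by simpa using LinearMap.congr_fun this x)
    | succ i => exact .left_of_isShortExact hse (ih hC i (by omega)) (.of_injective hI)

/-- For torsion `K`, vanishing of `Ext^k(K, M)` passes to quotients: both groups are
computed by maps to the last term of the coresolution. -/
lemma HasProjInjCoresolution.extVanishes_quotient {K S : Type u} [AddCommGroup K] [Module Λ K]
    [AddCommGroup S] [Module Λ S] (hK : IsTorsion Λ K) (q : K →ₗ[Λ] S)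
    (hq : Function.Surjective q) (k : ℕ) : ∀ {M : ModuleCat.{u} Λ}, HasProjInjCoresolution k M →
      ExtVanishes Λ k K M → ExtVanishes Λ k S M := by
  induction k with
  | zero =>
    intro M _ h
    rw [ExtVanishes.zero_iff] at h ⊢
    intro f
    ext y
    obtain ⟨x, rfl⟩ := hq y
    exact LinearMap.congr_fun (h (f ∘ₗ q)) x
  | succ k ih =>
    rintro M ⟨I, C, f, g, hse, hP, hI, hC⟩ h
    refine .left_of_isShortExact hse (ih hC (.right_of_isShortExact hse ?_ h)) (.of_injective hI)
    cases k with
    | zero => exact ExtVanishes.zero_iff.2 fun u => hK.eq_zero_of_projective u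
    | succ k => exact .of_injective hI

lemma IsShortExact.exists_lift_left {A B C X : Type u} [AddCommGroup A] [Module Λ A]
    [AddCommGroup B] [Module Λ B] [AddCommGroup C] [Module Λ C] [AddCommGroup X] [Module Λ X]
    {f : A →ₗ[Λ] B} {g : B →ₗ[Λ] C} (h : IsShortExact f g) (u : X →ₗ[Λ] B) (hu : g ∘ₗ u = 0) :
    ∃ v : X →ₗ[Λ] A, f ∘ₗ v = u := by
  let e := LinearEquiv.ofInjective f h.injective
  refine ⟨e.symm.toLinearMap ∘ₗ u.codRestrict (LinearMap.range f)
    fun x => (h.exact _).1 (LinearMap.congr_fun hu x), LinearMap.ext fun x => ?_⟩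
  exact congrArg Subtype.val (e.apply_symm_apply _)

/-- The endomorphisms of `M` act transitively on the nonzero elements of `Ext^k(S, M)`: in degree
`0` this is injectivity of `M`, and in general an endomorphism of the last term of the coresolution
lifts along the projective terms. -/
lemma HasProjInjCoresolution.exists_endomorphism {S : Type u} [AddCommGroup S] [Module Λ S]
    [IsSimpleModule Λ S] (k : ℕ) : ∀ {M : ModuleCat.{u} Λ}, HasProjInjCoresolution k M →
      ∀ a b : Ext (ModuleCat.of Λ S) (ModuleCat.of Λ M) k, a ≠ 0 →
        ∃ u : M →ₗ[Λ] M, a.comp (Ext.mk₀ (ModuleCat.ofHom u)) (add_zero k) = b := by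
  induction k with
  | zero =>
    intro M hM a b ha
    obtain ⟨f, rfl⟩ := (Ext.mk₀_bijective _ _).2 a
    obtain ⟨g, rfl⟩ := (Ext.mk₀_bijective _ _).2 b
    have hf : f.hom ≠ 0 := fun h => ha (by
      rw [Ext.mk₀_eq_zero_iff]
      exact ModuleCat.hom_ext h)
    obtain ⟨u, hu⟩ := hM.out f.hom (LinearMap.injective_of_ne_zero hf) g.hom
    refine ⟨u, ?_⟩
    rw [Ext.mk₀_comp_mk₀]
    exact congrArg _ (ModuleCat.hom_ext (LinearMap.ext hu))
  | succ k ih =>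
    rintro M ⟨I, C, f, g, hse, hP, hI, hC⟩ a b ha
    obtain ⟨c, rfl⟩ := Ext.covariant_sequence_exact₁ _ hse.shortExact a
      (ExtVanishes.of_injective hI _) rfl
    obtain ⟨c', rfl⟩ := Ext.covariant_sequence_exact₁ _ hse.shortExact b
      (ExtVanishes.of_injective hI _) rfl
    obtain ⟨w, hw⟩ := ih hC c c' (by rintro rfl; exact ha (by rw [Ext.zero_comp]))
    obtain ⟨φ, hφ⟩ := Module.projective_lifting_property g (w ∘ₗ g) hse.surjective
    obtain ⟨ψ, hψ⟩ := hse.exists_lift_left (φ ∘ₗ f) (by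
      rw [← LinearMap.comp_assoc, hφ, LinearMap.comp_assoc, hse.exact.linearMap_comp_eq_zero,
        LinearMap.comp_zero])
    let α : hse.toShortComplex ⟶ hse.toShortComplex :=
      { τ₁ := ModuleCat.ofHom ψ
        τ₂ := ModuleCat.ofHom φ
        τ₃ := ModuleCat.ofHom w
        comm₁₂ := ModuleCat.hom_ext hψ
        comm₂₃ := ModuleCat.hom_ext hφ }
    refine ⟨ψ, ?_⟩
    have hnat := ShortComplex.ShortExact.extClass_naturality hse.shortExact hse.shortExact α
    rw [Ext.comp_assoc_of_third_deg_zero]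
    refine (congrArg (fun t => c.comp t rfl) hnat).trans ?_
    rw [← Ext.comp_assoc_of_second_deg_zero]
    exact congrArg (fun t => Ext.comp t _ rfl) hw

end Coresolution

/-! ### Simple modules are detected by extensions with values in the ring -/

section Detection

variable {Λ : Type u} [Ring Λ]

/-- An essential extension of `Λ` that is projective is finitely generated: finitely many
coordinates already separate the elements of `Λ`. -/
lemma finite_of_isEssential [IsArtinianRing Λ] {E : Type u} [AddCommGroup E] [Module Λ E]
    [Module.Projective Λ E] (ι : Λ →ₗ[Λ] E) (hι : Function.Injective ι)
    (hess : IsEssential (LinearMap.range ι)) : Module.Finite Λ E := by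
  obtain ⟨s, hs⟩ := Finset.exists_inf_le fun f : E →ₗ[Λ] Λ => LinearMap.ker (f ∘ₗ ι)
  let F : E →ₗ[Λ] (s → Λ) := LinearMap.pi fun f => f.1
  refine Module.Finite.of_injective F (hess.injective_of_comp F ?_)
  refine (injective_iff_map_eq_zero _).2 fun x hx => ?_
  by_contra hx0
  obtain ⟨f, hf⟩ := exists_linearForm_ne_zero_of_projective (Λ := Λ)
    ((map_ne_zero_iff ι hι).2 hx0)
  exact hf (hs f (Submodule.mem_finsetInf.2 fun g hg => congrFun hx ⟨g, hg⟩))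

/-- If `domdim Λ ≥ 1`, a finitely generated module `M` of injective dimension at most `k` with no
extensions `Ext^i(S, M)`, `i ≤ k`, from torsion simple modules `S` is injective and projective. -/
lemma injective_and_projective_of_extVanishes [IsArtinianRing Λ] {E : ModuleCat.{u} Λ}
    (ι : Λ →ₗ[Λ] E) (hι : Function.Injective ι) (hfin : Module.Finite Λ E)
    (hP : Module.Projective Λ E) (hI : Module.Injective Λ E) (k : ℕ) :
    ∀ {M : Type u} [AddCommGroup M] [Module Λ M] [Module.Finite Λ M],
      (∀ (S : Type u) [AddCommGroup S] [Module Λ S] [IsSimpleModule Λ S], IsTorsion Λ S →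
        ∀ i ≤ k, ExtVanishes Λ i S M) →
      (∀ (Y : Type u) [AddCommGroup Y] [Module Λ Y], ExtVanishes Λ (k + 1) Y M) →
      Module.Injective Λ M ∧ Module.Projective Λ M := by
  have hemb : ∀ {M : Type u} [AddCommGroup M] [Module Λ M] [Module.Finite Λ M],
      (∀ (S : Type u) [AddCommGroup S] [Module Λ S] [IsSimpleModule Λ S], IsTorsion Λ S →
        ExtVanishes Λ 0 S M) → EmbedsInFree Λ M := by
    intro M _ _ _ h
    refine embedsInFree_of_simple ⟨E, ι, hP, hI, hι⟩ fun S hS ht => ?_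
    have h0 := ExtVanishes.zero_iff.1 (h S ht) S.subtype
    have : Nontrivial S := IsSimpleModule.nontrivial Λ S
    obtain ⟨x, hx⟩ := exists_ne (0 : S)
    exact hx (Subtype.ext (LinearMap.congr_fun h0 x))
  induction k with
  | zero =>
    intro M _ _ _ hS hY
    obtain ⟨m, f, hf⟩ := hemb fun S _ _ _ ht => hS S ht 0 le_rfl
    have hM : Module.Injective Λ M := injective_of_extVanishes_one fun J => hY _
    exact ⟨hM, projective_of_injective_of_embedding hM f hf⟩
  | succ k ih =>
    intro M _ _ _ hS hY
    obtain ⟨m, f, hf⟩ := hemb fun S _ _ _ ht => hS S ht 0 (by omega)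
    have hQI : Module.Injective Λ (Fin m → E) := inferInstance
    have hQP : Module.Projective Λ (Fin m → E) :=
      Module.Projective.of_equiv' (DirectSum.linearEquivFunOnFintype Λ (Fin m) fun _ => E)
    let f' : M →ₗ[Λ] (Fin m → E) := ι.compLeft (Fin m) ∘ₗ f
    have hf' : Function.Injective f' := fun x y hxy =>
      hf (funext fun i => hι (congrFun hxy i))
    have hse := isShortExact_mkQ f' hf'
    obtain ⟨-, hC⟩ := ih (M := (Fin m → E) ⧸ LinearMap.range f')
      (fun S _ _ _ ht i hi => by
        refine .right_of_isShortExact hse ?_ (hS S ht (i + 1) (by omega))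
        cases i with
        | zero => exact ExtVanishes.zero_iff.2 fun u => ht.eq_zero_of_projective u
        | succ i => exact .of_injective hQI)
      (fun Y _ _ => .right_of_isShortExact hse (.of_injective hQI) (hY Y))
    obtain ⟨v, hv⟩ := (ExtVanishes.of_projective (i := 0) (Y := M)).exists_extension hse
      LinearMap.id
    exact ⟨injective_of_retract f' v hv hQI, Module.Projective.of_split f' v hv⟩

lemma ext_comp_pow {X : Type u} [AddCommGroup X] [Module Λ X] {M : Type u} [AddCommGroup M]
    [Module Λ M] {k : ℕ} (e : Ext (ModuleCat.of Λ X) (ModuleCat.of Λ M) k) (w : Module.End Λ M)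
    (h : e.comp (Ext.mk₀ (ModuleCat.ofHom w)) (add_zero k) = e) (m : ℕ) :
    e.comp (Ext.mk₀ (ModuleCat.ofHom (w ^ m))) (add_zero k) = e := by
  induction m with
  | zero => exact e.comp_mk₀_id
  | succ m ih =>
    have : ModuleCat.ofHom (w ^ (m + 1)) = ModuleCat.ofHom w ≫ ModuleCat.ofHom (w ^ m) := by
      rw [← ModuleCat.ofHom_comp, pow_succ]
    rw [this, ← Ext.mk₀_comp_mk₀, ← Ext.comp_assoc_of_third_deg_zero, h, ih]

/-- If maps `u`, `v` between projective covers of simple modules exchange two nonzero extension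
classes, then the simple modules are isomorphic, as `v ∘ u` is not nilpotent. -/
lemma IsLocalCover.nonempty_equiv_of_ext [IsArtinianRing Λ] {P₁ S₁ P₂ S₂ X : Type u}
    [AddCommGroup P₁] [Module Λ P₁] [AddCommGroup S₁] [Module Λ S₁] [AddCommGroup P₂]
    [Module Λ P₂] [AddCommGroup S₂] [Module Λ S₂] [AddCommGroup X] [Module Λ X]
    [IsSimpleModule Λ S₁] [IsSimpleModule Λ S₂] [Module.Finite Λ P₁] {π₁ : P₁ →ₗ[Λ] S₁}
    {π₂ : P₂ →ₗ[Λ] S₂} (h₁ : IsLocalCover π₁) (h₂ : IsLocalCover π₂) {k : ℕ}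
    (e₁ : Ext (ModuleCat.of Λ X) (ModuleCat.of Λ P₁) k)
    (e₂ : Ext (ModuleCat.of Λ X) (ModuleCat.of Λ P₂) k) (he₁ : e₁ ≠ 0)
    (u : P₁ →ₗ[Λ] P₂) (v : P₂ →ₗ[Λ] P₁)
    (hu : e₁.comp (Ext.mk₀ (ModuleCat.ofHom u)) (add_zero k) = e₂)
    (hv : e₂.comp (Ext.mk₀ (ModuleCat.ofHom v)) (add_zero k) = e₁) :
    Nonempty (S₁ ≃ₗ[Λ] S₂) := by
  by_contra hne
  obtain ⟨m, hm⟩ := h₁.exists_pow_eq_zero h₂ (not_nonempty_iff.1 hne) u v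
  have h := ext_comp_pow e₁ (v ∘ₗ u) (by
    rw [ModuleCat.ofHom_comp, ← Ext.mk₀_comp_mk₀, ← Ext.comp_assoc_of_third_deg_zero, hu, hv]) m
  rw [hm] at h
  apply he₁
  rw [← h]
  have : Ext.mk₀ (ModuleCat.ofHom (0 : Module.End Λ P₁)) = 0 := Ext.mk₀_zero _ _
  rw [this, Ext.comp_zero]

/-- If `id Λ ≤ n + 1 ≤ domdim Λ`, every simple module is either a submodule of `Λ` or has a
nonzero extension group `Ext^(n+1)` with `Λ`. Attach to each simple module `S` with projective cover
`P` a simple module `S'`: a submodule of `P` if `P` is injective, and otherwise a torsion module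
with `Ext^(n+1)(S', P) ≠ 0`. This is injective on isomorphism classes, hence surjective, as there are
finitely many simple modules. -/
lemma not_extVanishes_of_simple [IsArtinianRing Λ] {E : ModuleCat.{u} Λ}
    (ι : Λ →ₗ[Λ] E) (hι : Function.Injective ι) (hfin : Module.Finite Λ E)
    (hP : Module.Projective Λ E) (hI : Module.Injective Λ E) (n : ℕ)
    (hcores : HasProjInjCoresolution (n + 1) (ModuleCat.of Λ Λ))
    (hid : ∀ (Y : Type u) [AddCommGroup Y] [Module Λ Y], ExtVanishes Λ (n + 2) Y Λ)
    (S : Type u) [AddCommGroup S] [Module Λ S] [IsSimpleModule Λ S] (hS : IsTorsion Λ S) :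
    ¬ ExtVanishes Λ (n + 1) S Λ := by
  obtain ⟨κ, _, T, hT, hirr, hall⟩ := exists_finite_simples Λ
  choose P r π hr hπ using fun i : κ => exists_isLocalCover (Λ := Λ) (T i)
  have hproj : ∀ i, Module.Projective Λ (P i) := fun i =>
    Module.Projective.of_split (P i).subtype (r i) (hr i)
  let Rel : κ → κ → Prop := fun i j =>
    (Module.Injective Λ (P i) ∧ ∃ f : T j →ₗ[Λ] P i, f ≠ 0) ∨
      (IsTorsion Λ (T j) ∧ ¬ ExtVanishes Λ (n + 1) (T j) (P i))
  have hex : ∀ i, ∃ j, Rel i j := by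
    intro i
    have hnt : Nontrivial (T i) := IsSimpleModule.nontrivial Λ _
    have : Nontrivial (P i) := (hπ i).surjective.nontrivial
    by_cases hi : Module.Injective Λ (P i)
    · obtain ⟨L, -, hL⟩ := exists_simple_submodule_le (bot_ne_top (α := Submodule Λ (P i))).symm
      obtain ⟨j, ⟨e⟩⟩ := hall L
      refine ⟨j, Or.inl ⟨hi, L.subtype ∘ₗ e.symm.toLinearMap, fun h0 => ?_⟩⟩
      have : Nontrivial L := IsSimpleModule.nontrivial Λ L
      obtain ⟨x, hx⟩ := exists_ne (0 : L)
      exact hx (Subtype.ext (by simpa using LinearMap.congr_fun h0 (e x)))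
    · by_contra! H
      refine hi (injective_and_projective_of_extVanishes ι hι hfin hP hI (n + 1)
        (fun S _ _ _ ht k hk => ?_)
        (fun Y _ _ => (hid Y).retract_right (P i).subtype (r i) (hr i))).1
      obtain hk | rfl := Nat.lt_or_eq_of_le hk
      · exact (HasProjInjCoresolution.extVanishes ht _ hcores k hk).retract_right
          (P i).subtype (r i) (hr i)
      · obtain ⟨j, ⟨e⟩⟩ := hall S
        by_contra hne
        refine H j (Or.inr ⟨ht.of_surjective e.toLinearMap e.surjective, fun hj => hne ?_⟩)
        exact hj.retract_left e.toLinearMap e.symm.toLinearMap (by ext; simp)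
  choose g hg using hex
  have hginj : Function.Injective g := by
    intro i i' hii
    have hi := hg i
    have hi' := hg i'
    rw [← hii] at hi'
    set j := g i
    have hnot : ∀ i, IsTorsion Λ (T j) → (f : T j →ₗ[Λ] P i) → f = 0 :=
      fun i ht f => ht.eq_zero_of_projective f
    apply hirr
    rcases hi with ⟨hiI, f, hf⟩ | ⟨ht, he⟩ <;> rcases hi' with ⟨hiI', f', hf'⟩ | ⟨ht', he'⟩
    · obtain ⟨u, hu⟩ := hiI'.out f (LinearMap.injective_of_ne_zero hf) f'
      obtain ⟨v, hv⟩ := hiI.out f' (LinearMap.injective_of_ne_zero hf') f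
      refine (hπ i).nonempty_equiv_of_ext (hπ i') (Ext.mk₀ (ModuleCat.ofHom f))
        (Ext.mk₀ (ModuleCat.ofHom f')) (fun h0 => hf ?_) u v ?_ ?_
      · exact congrArg ModuleCat.Hom.hom ((Ext.mk₀_eq_zero_iff _).1 h0)
      · rw [Ext.mk₀_comp_mk₀]
        exact congrArg _ (ModuleCat.hom_ext (LinearMap.ext hu))
      · rw [Ext.mk₀_comp_mk₀]
        exact congrArg _ (ModuleCat.hom_ext (LinearMap.ext hv))
    · exact absurd (hnot i ht' f) hf
    · exact absurd (hnot i' ht f') hf'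
    · -- endomorphisms of `Λ` that exchange the two classes restrict to the two summands
      simp only [ExtVanishes, not_forall] at he he'
      obtain ⟨e, he⟩ := he
      obtain ⟨e', he'⟩ := he'
      have hret : ∀ i, ModuleCat.ofHom (P i).subtype ≫ ModuleCat.ofHom (r i) = 𝟙 _ := fun i => by
        rw [← ModuleCat.ofHom_comp, hr i]
        rfl
      have hback : ∀ i (x : Ext (ModuleCat.of Λ (T j)) (ModuleCat.of Λ (P i)) (n + 1)),
          (x.comp (Ext.mk₀ (ModuleCat.ofHom (P i).subtype)) (add_zero _)).comp
            (Ext.mk₀ (ModuleCat.ofHom (r i))) (add_zero _) = x := fun i x => by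
        rw [Ext.comp_assoc_of_third_deg_zero, Ext.mk₀_comp_mk₀, hret, Ext.comp_mk₀_id]
      have hne : ∀ i (x : Ext (ModuleCat.of Λ (T j)) (ModuleCat.of Λ (P i)) (n + 1)), x ≠ 0 →
          x.comp (Ext.mk₀ (ModuleCat.ofHom (P i).subtype)) (add_zero _) ≠ 0 :=
        fun i x hx h0 => hx (by rw [← hback i x, h0, Ext.zero_comp])
      have hmove : ∀ i i' (x : Ext (ModuleCat.of Λ (T j)) (ModuleCat.of Λ (P i)) (n + 1))
          (x' : Ext (ModuleCat.of Λ (T j)) (ModuleCat.of Λ (P i')) (n + 1)), x ≠ 0 →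
          ∃ u : P i →ₗ[Λ] P i',
            x.comp (Ext.mk₀ (ModuleCat.ofHom u)) (add_zero _) = x' := fun i i' x x' hx => by
        obtain ⟨u, hu⟩ := HasProjInjCoresolution.exists_endomorphism _ hcores _
          (x'.comp (Ext.mk₀ (ModuleCat.ofHom (P i').subtype)) (add_zero _)) (hne i x hx)
        refine ⟨r i' ∘ₗ u ∘ₗ (P i).subtype, ?_⟩
        rw [ModuleCat.ofHom_comp, ModuleCat.ofHom_comp, ← Ext.mk₀_comp_mk₀, ← Ext.mk₀_comp_mk₀,
          ← Ext.comp_assoc_of_third_deg_zero, ← Ext.comp_assoc_of_third_deg_zero]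
        refine Eq.trans ?_ (hback i' x')
        exact congrArg (fun t => Ext.comp t _ _) hu
      obtain ⟨u, hu⟩ := hmove i i' e e' he
      obtain ⟨v, hv⟩ := hmove i' i e' e he'
      exact (hπ i).nonempty_equiv_of_ext (hπ i') e e' he u v hu hv
  obtain ⟨j, ⟨e⟩⟩ := hall S
  obtain ⟨i, rfl⟩ := Finite.surjective_of_injective hginj j
  have ht : IsTorsion Λ (T (g i)) := hS.of_surjective e.toLinearMap e.surjective
  intro hvan
  rcases hg i with ⟨-, f, hf⟩ | ⟨-, hne⟩
  · exact hf (ht.eq_zero_of_projective f)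
  · exact hne ((hvan.retract_left e.symm.toLinearMap e.toLinearMap (by ext; simp)).retract_right
      (P i).subtype (r i) (hr i))

end Detection

/-! ### Approximations by free modules -/

section GorensteinProjectives

variable {Λ : Type u} [Ring Λ]

/-- Over an Artin algebra, every finitely generated module `X` has a map to a free module of finite
rank through which all linear forms on `X` factor, since `Hom(X, Λ)` is finitely generated over the
base ring. -/
lemma exists_left_approximation (R : Type*) [CommRing R] [IsNoetherianRing R] [Algebra R Λ]
    [Module.Finite R Λ] (X : Type u) [AddCommGroup X] [Module Λ X] [Module.Finite Λ X] :
    ∃ (m : ℕ) (F : X →ₗ[Λ] (Fin m → Λ)),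
      ∀ u : X →ₗ[Λ] Λ, ∃ v : (Fin m → Λ) →ₗ[Λ] Λ, v ∘ₗ F = u := by
  obtain ⟨k, x, hx⟩ := Module.Finite.exists_fin (R := Λ) (M := X)
  let ev : (X →ₗ[Λ] Λ) →ₗ[R] (Fin k → Λ) :=
    { toFun := fun f i => f (x i)
      map_add' := fun _ _ => rfl
      map_smul' := fun _ _ => rfl }
  have hev : Function.Injective ev := fun f g hfg =>
    LinearMap.ext_on_range hx fun i => congrFun hfg i
  have : Module.Finite R (X →ₗ[Λ] Λ) := Module.Finite.of_injective ev hev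
  obtain ⟨m, s, hs⟩ := Module.Finite.exists_fin (R := R) (M := X →ₗ[Λ] Λ)
  refine ⟨m, LinearMap.pi s, fun u => ?_⟩
  obtain ⟨c, hc⟩ := (Submodule.mem_span_range_iff_exists_fun R).1
    (hs ▸ Submodule.mem_top : u ∈ Submodule.span R (Set.range s))
  refine ⟨∑ i, c i • (LinearMap.proj i : (Fin m → Λ) →ₗ[Λ] Λ), ?_⟩
  rw [← hc]
  ext y
  simp [LinearMap.sum_apply]

/-- If all finitely generated modules `X` with `Ext^i(X, Λ) = 0` for `i ≥ 1` embed in free modules,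
then all of them are Gorenstein projective. -/
lemma isGorensteinProjective_of_extVanishes (R : Type*) [CommRing R] [IsNoetherianRing R]
    [Algebra R Λ] [Module.Finite R Λ] [IsNoetherianRing Λ]
    (h : ∀ (X : Type u) [AddCommGroup X] [Module Λ X] [Module.Finite Λ X],
      (∀ i, ExtVanishes Λ (i + 1) X Λ) → EmbedsInFree Λ X)
    (M : ModuleCat.{u} Λ) (hfin : Module.Finite Λ M) (hM : ∀ i, ExtVanishes Λ (i + 1) M Λ) :
    IsGorensteinProjective Λ M := by
  refine isGorensteinProjective_of_class
    (fun X => Module.Finite Λ X ∧ ∀ i, ExtVanishes Λ (i + 1) X Λ) ?_ ?_ M ⟨hfin, hM⟩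
  · rintro X ⟨_, hX⟩
    obtain ⟨m, F, hF⟩ := exists_left_approximation R (Λ := Λ) X
    have hinj : Function.Injective F := by
      obtain ⟨k, f, hf⟩ := h X hX
      refine (injective_iff_map_eq_zero _).2 fun x hx => hf ?_
      rw [map_zero]
      ext i
      obtain ⟨v, hv⟩ := hF (LinearMap.proj i ∘ₗ f)
      have := LinearMap.congr_fun hv x
      simp only [LinearMap.comp_apply, hx, map_zero] at this
      exact this.symm
    have hse := isShortExact_mkQ F hinj
    refine ⟨ModuleCat.of Λ ((Fin m → Λ) ⧸ LinearMap.range F),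
      ⟨inferInstanceAs (Module.Finite Λ ((Fin m → Λ) ⧸ LinearMap.range F)), ?_⟩,
      ModuleCat.of Λ (Fin m → Λ), F, _, inferInstanceAs (Module.Finite Λ (Fin m → Λ)),
      inferInstanceAs (Module.Projective Λ (Fin m → Λ)), hse, hF⟩
    rintro (_ | i)
    · exact .one_of_extension hse .of_projective hF
    · exact .contra_right_of_isShortExact hse (hX i) .of_projective
  · rintro Y ⟨_, hY⟩
    obtain ⟨m, p, hp⟩ := Module.Finite.exists_fin' Λ Y
    have hse := isShortExact_ker p hp
    exact ⟨ModuleCat.of Λ (LinearMap.ker p),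
      ⟨inferInstanceAs (Module.Finite Λ (LinearMap.ker p)), fun i =>
        .contra_left_of_isShortExact hse .of_projective (hY (i + 1))⟩,
      ModuleCat.of Λ (Fin m → Λ), _, p, inferInstanceAs (Module.Finite Λ (Fin m → Λ)),
      inferInstanceAs (Module.Projective Λ (Fin m → Λ)), hse,
      fun u => (hY 0).exists_extension hse u⟩

/-- When the modules with `Ext^i(X, Λ) = 0` for `i ≥ 1` are Gorenstein projective, the Gorenstein
projective dimension is detected by `Ext` groups with values in `Λ`. -/
lemma hasGpdLE_of_extVanishes [IsNoetherianRing Λ]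
    (h : ∀ M : ModuleCat.{u} Λ, Module.Finite Λ M → (∀ i, ExtVanishes Λ (i + 1) M Λ) →
      IsGorensteinProjective Λ M) (k : ℕ) :
    ∀ M : ModuleCat.{u} Λ, Module.Finite Λ M → (∀ i, k < i → ExtVanishes Λ i M Λ) →
      HasGpdLE k M := by
  induction k with
  | zero => exact fun M hM hv => h M hM fun i => hv _ (Nat.succ_pos i)
  | succ k ih =>
    intro M hM hv
    obtain ⟨m, p, hp⟩ := Module.Finite.exists_fin' Λ M
    have hse := isShortExact_ker p hp
    refine ⟨ModuleCat.of Λ (LinearMap.ker p), ModuleCat.of Λ (Fin m → Λ), _, p, hse,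
      isGorensteinProjective_of_projective _ (inferInstanceAs (Module.Finite Λ (Fin m → Λ)))
        (inferInstanceAs (Module.Projective Λ (Fin m → Λ))),
      ih _ (inferInstanceAs (Module.Finite Λ (LinearMap.ker p))) fun i hi => ?_⟩
    obtain ⟨i, rfl⟩ := Nat.exists_eq_succ_of_ne_zero (by omega : i ≠ 0)
    exact .contra_left_of_isShortExact hse .of_projective (hv _ (by omega))

lemma EmbedsInFree.extVanishes {n : ℕ}
    (hid : ∀ (Y : Type u) [AddCommGroup Y] [Module Λ Y] (i : ℕ), n + 2 ≤ i → ExtVanishes Λ i Y Λ)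
    {N : Type u} [AddCommGroup N] [Module Λ N] (hN : EmbedsInFree Λ N) (i : ℕ) (hi : n < i) :
    ExtVanishes Λ i N Λ := by
  obtain ⟨m, f, hf⟩ := hN
  obtain ⟨i, rfl⟩ := Nat.exists_eq_succ_of_ne_zero (by omega : i ≠ 0)
  exact .contra_left_of_isShortExact (isShortExact_mkQ f hf) .of_projective (hid _ _ (by omega))

end GorensteinProjectives

/-! ### The classes of modules, elementwise -/

section Reformulation

variable {Λ : Type u} [Ring Λ]

/-- The two equalities of classes, expressed elementwise. -/
lemma classes_eq_iff [IsNoetherianRing Λ] (n : ℕ) :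
    (gpLE n Λ = socGpLE n Λ ∧ socGpLE n Λ = sub Λ) ↔
      ∀ (N : Type u) [AddCommGroup N] [Module Λ N] [Module.Finite Λ N],
        (HasGpdLE n (ModuleCat.of Λ N) ↔ EmbedsInFree Λ N) ∧
          (EmbedsInFree Λ (socle Λ N) ↔ EmbedsInFree Λ N) := by
  constructor
  · rintro ⟨h₁, h₂⟩ N _ _ _
    have hgp : ∀ (N : Type u) [AddCommGroup N] [Module Λ N] [Module.Finite Λ N],
        HasGpdLE n (ModuleCat.of Λ N) ↔ EmbedsInFree Λ N := fun N _ _ _ => by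
      rw [← gpd_le_iff]
      exact Set.ext_iff.1 (h₁.trans h₂) (FGModuleCat.of Λ N)
    refine ⟨hgp N, ?_⟩
    rw [← hgp (socle Λ N), ← gpd_le_iff]
    exact Set.ext_iff.1 h₂ (FGModuleCat.of Λ N)
  · intro h
    have hs : socGpLE n Λ = sub Λ := Set.ext fun N => by
      change gpd Λ (socle Λ N) ≤ n ↔ EmbedsInFree Λ N
      rw [gpd_le_iff, (h _).1, (h N).2]
    refine ⟨Eq.trans (Set.ext fun N => ?_) hs.symm, hs⟩
    change gpd Λ N ≤ n ↔ EmbedsInFree Λ N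
    rw [gpd_le_iff, (h N).1]

end Reformulation

/-! ### Minimal Auslander-Gorenstein algebras -/

section AuslanderGorenstein

variable {Λ : Type u} [Ring Λ]

lemma le_domdim_iff (n : ℕ) :
    ((n + 1 : ℕ) : ℕ∞) ≤ domdim Λ ↔ ∃ r : MinimalInjectiveCoresolution Λ Λ,
      ∀ j < n + 1, Module.Projective Λ (r.I j) := by
  constructor
  · intro h
    obtain ⟨m, ⟨r, hr⟩, hm⟩ := lt_sSup_iff.1
      (lt_of_lt_of_le (by exact_mod_cast Nat.lt_succ_self n : (n : ℕ∞) < (n + 1 : ℕ)) h)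
    exact ⟨r, fun j hj => hr j (lt_of_le_of_lt (by exact_mod_cast Nat.lt_succ_iff.1 hj) hm)⟩
  · rintro ⟨r, hr⟩
    exact le_sSup ⟨r, fun j hj => hr j (by exact_mod_cast hj)⟩

/-- Over a minimal `n`-Auslander-Gorenstein algebra, the modules of Gorenstein projective dimension
at most `n` are the submodules of free modules, and these are detected on the socle. -/
theorem IsMinimalAuslanderGorenstein.hasGpdLE_iff (R : Type*) [CommRing R]
    [IsNoetherianRing R] [Algebra R Λ] [Module.Finite R Λ] [IsArtinianRing Λ] {n : ℕ}
    (h : IsMinimalAuslanderGorenstein n Λ) (N : Type u) [AddCommGroup N] [Module Λ N]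
    [Module.Finite Λ N] :
    (HasGpdLE n (ModuleCat.of Λ N) ↔ EmbedsInFree Λ N) ∧
      (EmbedsInFree Λ (socle Λ N) ↔ EmbedsInFree Λ N) := by
  obtain ⟨hid, hdom⟩ := h
  rw [injectiveDimension_le_iff_extVanishes] at hid
  obtain ⟨r, hr⟩ := (le_domdim_iff n).1 hdom
  have hcores := r.hasProjInjCoresolution (n + 1) hr fun Y _ _ => hid Y _ le_rfl
  have hP := hr 0 (Nat.succ_pos n)
  have hI := r.injective_module 0
  have hfin : Module.Finite Λ (r.I 0) := finite_of_isEssential r.ι r.injective_ι r.essential_zero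
  have hpi : EmbedsInProjectiveInjective Λ := ⟨r.I 0, r.ι, hP, hI, r.injective_ι⟩
  refine ⟨⟨fun hN => ?_, fun hN => ?_⟩, (embedsInFree_iff_socle hpi).symm⟩
  · refine embedsInFree_of_torsionSubmodule_eq_bot ((Submodule.eq_bot_iff _).2 fun x hx => ?_)
    have ht := isTorsion_of_le_torsionSubmodule hpi (torsionSubmodule Λ N) le_rfl
    have hv := HasGpdLE.extVanishes_right (n := n) (fun i hi =>
      HasProjInjCoresolution.extVanishes ht _ hcores i (Nat.lt_succ_of_le hi)) n hN 0 (by omega)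
    exact LinearMap.congr_fun (ExtVanishes.zero_iff.1 hv (torsionSubmodule Λ N).subtype) ⟨x, hx⟩
  · refine hasGpdLE_of_extVanishes (isGorensteinProjective_of_extVanishes R ?_) n _ ‹_›
      (hN.extVanishes hid)
    intro X _ _ _ hX
    refine embedsInFree_of_torsionSubmodule_eq_bot ?_
    have ht := isTorsion_of_le_torsionSubmodule hpi (torsionSubmodule Λ X) le_rfl
    -- the top `Ext` group of the torsion submodule lies between two groups that vanish
    have hv : ExtVanishes Λ (n + 1) (torsionSubmodule Λ X) Λ :=
      .contra_left_of_isShortExact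
        (⟨Subtype.val_injective, Submodule.mkQ_surjective _, LinearMap.exact_subtype_mkQ _⟩ :
          IsShortExact (torsionSubmodule Λ X).subtype (torsionSubmodule Λ X).mkQ)
        (hX n) ((embedsInFree_of_torsionSubmodule_eq_bot
          torsionSubmodule_quotient_eq_bot).extVanishes hid _ (by omega))
    by_contra hne
    have : Nontrivial (torsionSubmodule Λ X) := Submodule.nontrivial_iff_ne_bot.2 hne
    obtain ⟨L, hL⟩ := exists_simple_quotient (Λ := Λ) (M := torsionSubmodule Λ X)
    exact not_extVanishes_of_simple r.ι r.injective_ι hfin hP hI n hcores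
      (fun Y _ _ => hid Y _ le_rfl) _ (ht.of_surjective L.mkQ L.mkQ_surjective)
      (HasProjInjCoresolution.extVanishes_quotient ht L.mkQ L.mkQ_surjective _ hcores hv)

/-- If embedding in a free module is detected on the socle, then the injective hull of a
submodule of a free module is finitely generated: its finitely generated submodules that contain
`N` embed in `Λ ^ d` for `d` the length of `N`, so that their lengths are bounded. -/
lemma embedsInFree_injective_hull [IsArtinianRing Λ]
    (hsoc : ∀ (L : Type u) [AddCommGroup L] [Module Λ L] [Module.Finite Λ L],
      EmbedsInFree Λ (socle Λ L) → EmbedsInFree Λ L)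
    {N E : Type u} [AddCommGroup N] [Module Λ N] [AddCommGroup E] [Module Λ E]
    (hN : EmbedsInFree Λ N) (ι : N →ₗ[Λ] E) (hι : Function.Injective ι)
    (hess : IsEssential (LinearMap.range ι)) : EmbedsInFree Λ E := by
  have hNfin : Module.Finite Λ N := hN.finite
  obtain ⟨d, hd⟩ := ENat.ne_top_iff_exists.1 (Module.length_ne_top (R := Λ) (M := N))
  let e : N ≃ₗ[Λ] LinearMap.range ι := LinearEquiv.ofInjective ι hι
  have hemb : ∀ L : Submodule Λ E, Module.Finite Λ L → LinearMap.range ι ≤ L →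
      EmbedsInFree Λ L ∧ Module.length Λ L ≤ Module.length Λ (Fin d → Λ) := by
    intro L hL hNL
    let N' := (LinearMap.range ι).comap L.subtype
    let e' : N' ≃ₗ[Λ] N := (Submodule.comapSubtypeEquivOfLe hNL).trans e.symm
    have hess' : IsEssential N' := fun T hT => by
      refine Submodule.map_injective_of_injective L.subtype_injective
        ((hess _ ((Submodule.eq_bot_iff _).2 ?_)).trans (Submodule.map_bot _).symm)
      rintro _ ⟨hx, y, hy, rfl⟩
      have : y ∈ N' ⊓ T := ⟨hx, hy⟩
      rw [hT] at this
      exact congrArg Subtype.val this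
    have hL' : EmbedsInFree Λ L := hsoc L (hN.of_embedding
      (e'.toLinearMap ∘ₗ Submodule.inclusion hess'.socle_le)
      (e'.injective.comp (Submodule.inclusion_injective _)))
    refine ⟨hL', ?_⟩
    have hlen : Order.height N' ≤ d := by
      rw [← Module.length_submodule, e'.length_eq, hd]
    obtain ⟨k, f, hf⟩ := hL'
    obtain ⟨F, hF⟩ := exists_pi_map_inf_ker_eq_bot d N' (fun x _ hx => by
      by_contra! H
      exact hx (hf (by ext i; simpa using H (LinearMap.proj i ∘ₗ f)))) hlen
    exact Module.length_le_of_injective F (LinearMap.ker_eq_bot.1 (hess' _ hF))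
  obtain ⟨B, hB⟩ := ENat.ne_top_iff_exists.1 (Module.length_ne_top (R := Λ) (M := Fin d → Λ))
  -- choose `L` of maximal length
  obtain ⟨L, ⟨hLfin, hNL⟩, hmax⟩ := (measure fun L : Submodule Λ E =>
    B - (Module.length Λ L).toNat).wf.has_min
      {L | Module.Finite Λ L ∧ LinearMap.range ι ≤ L} ⟨_, Module.Finite.equiv e, le_rfl⟩
  have htop : L = ⊤ := by
    refine eq_top_iff.2 fun x _ => ?_
    by_contra hx
    have hfin' : Module.Finite Λ (L ⊔ Submodule.span Λ {x} : Submodule Λ E) := inferInstance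
    refine hmax (L ⊔ Submodule.span Λ {x}) ⟨hfin', hNL.trans le_sup_left⟩ ?_
    have hlt : Module.length Λ L < Module.length Λ (L ⊔ Submodule.span Λ {x} : Submodule Λ E) := by
      rw [← (Submodule.comapSubtypeEquivOfLe
        (le_sup_left : L ≤ L ⊔ Submodule.span Λ {x})).length_eq]
      refine Submodule.length_lt fun h => hx ?_
      have hx' : x ∈ L ⊔ Submodule.span Λ {x} :=
        Submodule.mem_sup_right (Submodule.mem_span_singleton_self x)
      exact (h ▸ Submodule.mem_top :
        (⟨x, hx'⟩ : (L ⊔ Submodule.span Λ {x} : Submodule Λ E)) ∈ Submodule.comap _ L)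
    have hle := (hemb _ hfin' (hNL.trans le_sup_left)).2
    obtain ⟨a, ha⟩ := ENat.ne_top_iff_exists.1 (Module.length_ne_top (R := Λ) (M := L))
    obtain ⟨b, hb⟩ := ENat.ne_top_iff_exists.1
      (Module.length_ne_top (R := Λ) (M := (L ⊔ Submodule.span Λ {x} : Submodule Λ E)))
    change B - ENat.toNat _ < B - ENat.toNat _
    rw [← ha, ← hb] at hlt
    rw [← hb, ← hB] at hle
    rw [← ha, ← hb]
    have h1 : a < b := by exact_mod_cast hlt
    have h2 : b ≤ B := by exact_mod_cast hle
    simp only [ENat.toNat_natCast]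
    omega
  subst htop
  exact (hemb _ hLfin hNL).1.of_embedding Submodule.topEquiv.symm.toLinearMap
    Submodule.topEquiv.symm.injective

/-- Splice short exact sequences `0 → Z j → I j → Z (j + 1) → 0`, in which `I j` is an injective
hull of `Z j`, to a minimal injective coresolution of `Z 0`. -/
def MinimalInjectiveCoresolution.splice (Z I : ℕ → ModuleCat.{u} Λ) (f : ∀ j, Z j →ₗ[Λ] I j)
    (g : ∀ j, I j →ₗ[Λ] Z (j + 1)) (hI : ∀ j, Module.Injective Λ (I j))
    (h : ∀ j, IsShortExact (f j) (g j)) (hess : ∀ j, IsEssential (LinearMap.range (f j))) :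
    MinimalInjectiveCoresolution Λ (Z 0) where
  I := I
  ι := f 0
  d j := f (j + 1) ∘ₗ g j
  injective_module := hI
  injective_ι := (h 0).injective
  exact_zero x := (map_eq_zero_iff _ (h 1).injective).trans ((h 0).exact x)
  exact_succ j x := by
    refine ((map_eq_zero_iff _ (h (j + 2)).injective).trans ((h (j + 1)).exact x)).trans ⟨?_, ?_⟩
    · rintro ⟨y, rfl⟩
      obtain ⟨z, rfl⟩ := (h j).surjective y
      exact ⟨z, rfl⟩
    · rintro ⟨z, rfl⟩
      exact ⟨g j z, rfl⟩
  essential_zero := hess 0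
  essential_succ j := by
    rw [LinearMap.range_comp_of_range_eq_top _ (LinearMap.range_eq_top.2 (h j).surjective)]
    exact hess _

/-- Minimal injective coresolutions exist, together with the short exact sequences into which they
decompose. -/
lemma exists_minimalInjectiveCoresolution (M : ModuleCat.{u} Λ) :
    ∃ (r : MinimalInjectiveCoresolution Λ M) (Z : ℕ → ModuleCat.{u} Λ)
      (f : ∀ j, Z j →ₗ[Λ] r.I j) (g : ∀ j, r.I j →ₗ[Λ] Z (j + 1)), Z 0 = M ∧
        ∀ j, IsShortExact (f j) (g j) ∧ IsEssential (LinearMap.range (f j)) := by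
  have hhull : ∀ X : ModuleCat.{u} Λ, ∃ (E C : ModuleCat.{u} Λ) (ι : X →ₗ[Λ] E) (π : E →ₗ[Λ] C),
      Module.Injective Λ E ∧ IsShortExact ι π ∧ IsEssential (LinearMap.range ι) := fun X => by
    obtain ⟨E, ι, hE, hι, hess⟩ := exists_injective_hull (Λ := Λ) X
    exact ⟨E, ModuleCat.of Λ (E ⧸ LinearMap.range ι), ι, _, hE, isShortExact_mkQ ι hι, hess⟩
  choose E C ι π hE hse hess using hhull
  exact ⟨.splice (fun j => Nat.rec M (fun _ X => C X) j) (fun j => E _) (fun j => ι _)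
    (fun j => π _) (fun j => hE _) (fun j => hse _) (fun j => hess _), _, _, _, rfl,
    fun j => ⟨hse _, hess _⟩⟩

/-- If the modules of Gorenstein projective dimension at most `n` are the submodules
of free modules and are detected on the socle, then `Λ` is minimal `n`-Auslander-Gorenstein. The
cosyzygies `Z j` of `Λ` have Gorenstein projective dimension at most `j`, so that for `j ≤ n` they
embed in free modules and have projective injective hulls. -/
theorem isMinimalAuslanderGorenstein_of_hasGpdLE_iff [IsArtinianRing Λ] {n : ℕ}
    (h : ∀ (N : Type u) [AddCommGroup N] [Module Λ N] [Module.Finite Λ N],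
      (HasGpdLE n (ModuleCat.of Λ N) ↔ EmbedsInFree Λ N) ∧
        (EmbedsInFree Λ (socle Λ N) ↔ EmbedsInFree Λ N)) :
    IsMinimalAuslanderGorenstein n Λ := by
  constructor
  · rw [injectiveDimension_le_iff_extVanishes]
    refine extVanishes_of_cyclic fun J => ?_
    have hJ : EmbedsInFree Λ J :=
      embedsInFree_of_finite_projective.of_embedding J.subtype J.subtype_injective
    exact .contra_right_of_isShortExact
      (⟨Subtype.val_injective, J.mkQ_surjective, LinearMap.exact_subtype_mkQ J⟩ :
        IsShortExact J.subtype J.mkQ)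
      (HasGpdLE.extVanishes n ((h J).1.2 hJ) _ (Nat.lt_succ_self n)) .of_projective
  · rw [le_domdim_iff]
    obtain ⟨r, Z, f, g, hZ0, hZ⟩ := exists_minimalInjectiveCoresolution (ModuleCat.of Λ Λ)
    have hI : ∀ j ≤ n, Module.Finite Λ (Z j) → HasGpdLE j (Z j) →
        Module.Finite Λ (r.I j) ∧ Module.Projective Λ (r.I j) := fun j hj hfin hgpd => by
      have hsub : EmbedsInFree Λ (Z j) := (h (Z j)).1.1 (gpd_le_iff.1
        ((gpd_le_iff.2 hgpd).trans (by exact_mod_cast hj)))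
      have hE := embedsInFree_injective_hull (fun L _ _ _ => (h L).2.1) hsub (f j)
        (hZ j).1.injective (hZ j).2
      obtain ⟨m, F, hF⟩ := id hE
      exact ⟨hE.finite, projective_of_injective_of_embedding (r.injective_module j) F hF⟩
    have hZgpd : ∀ j ≤ n, Module.Finite Λ (Z j) ∧ HasGpdLE j (Z j) := by
      intro j
      induction j with
      | zero =>
        intro _
        rw [hZ0]
        exact ⟨inferInstanceAs (Module.Finite Λ Λ), isGorensteinProjective_of_projective _
          (inferInstanceAs (Module.Finite Λ Λ)) (inferInstanceAs (Module.Projective Λ Λ))⟩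
      | succ j ih =>
        intro hj
        obtain ⟨hfin, hgpd⟩ := ih (by omega)
        obtain ⟨hIf, hIp⟩ := hI j (by omega) hfin hgpd
        exact ⟨Module.Finite.of_surjective (g j) (hZ j).1.surjective, Z j, r.I j, f j, g j,
          (hZ j).1, isGorensteinProjective_of_projective _ hIf hIp, hgpd⟩
    exact ⟨r, fun j hj => (hI j (by omega) (hZgpd j (by omega)).1 (hZgpd j (by omega)).2).2⟩

end AuslanderGorenstein

end GorensteinSocle

theorem theorem4p3 {R : Type*} {Λ : Type u} [CommRing R] [IsArtinianRing R] [Ring Λ] [Algebra R Λ]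
    [Module.Finite R Λ] (n : ℕ) :
    GorensteinSocle.IsMinimalAuslanderGorenstein n Λ ↔
      (GorensteinSocle.gpLE n Λ = GorensteinSocle.socGpLE n Λ ∧
        GorensteinSocle.socGpLE n Λ = GorensteinSocle.sub Λ) := by
  have : IsArtinianRing Λ := IsArtinianRing.of_finite R Λ
  rw [GorensteinSocle.classes_eq_iff]
  exact ⟨fun h N _ _ _ => GorensteinSocle.IsMinimalAuslanderGorenstein.hasGpdLE_iff R h N,
    GorensteinSocle.isMinimalAuslanderGorenstein_of_hasGpdLE_iff⟩
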